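/- **Setting.** Let $\kappa>0$, $\Lambda>0$, and let $M=\{x\in\mathbb R^4:1<|x|<2\}\cong S^3\times(0,1)$, with the standard orientation, foliated by the slices $C_t=\{|x|=t\}\cong S^3$ (oriented by the outward normal); $t\to1$ is past infinity $\mathscr I^-$ and $t\to2$ is future infinity $\mathscr I^+$. Forms are smooth and complex valued on $M$. Spinor indices $A,B,\dots\in\{0,1\}$ are raised and lowered by $\xi^A=\varepsilon^{AB}\xi_B$, $\xi_B=\xi^A\varepsilon_{AB}$, $\varepsilon^{01}=\varepsilon_{01}=1$; round brackets denote symmetrization with weight one; repeated indices are summed. A *self-dual background* is a pair of symmetric spinor-valued forms, 2-forms $\Sigma_0^{AB}$ and connection 1-forms $\Gamma_{0\,AB}$, with $$D_0\Sigma_0^{AB}=0,\qquad F_{0\,AB}=\tfrac{\Lambda}{3}\Sigma_{0\,AB},\qquad \Sigma_0^{(AB}\wedge\Sigma_0^{CD)}=0 .$$ Here $D_0\alpha^{AB}=d\alpha^{AB}+2\Gamma_0{}^{(A}{}_C\wedge\alpha^{B)C}$ and $F_{0\,AB}=d\Gamma_{0\,AB}+\Gamma_{0\,AC}\wedge\Gamma_0{}^C{}_B$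 is the curvature of $D_0$. (Nondegeneracy of $\Sigma_0$ is not needed.) A *linearized solution* is $h=(\sigma^{AB},\gamma_{AB})$, symmetric 2- and 1-forms, with a totally symmetric smooth $\psi_{ABCD}$, such that $$D_0\sigma^{AB}=-2\gamma^{(A}{}_C\wedge\Sigma_0^{B)C},\qquad D_0\gamma_{AB}=\psi_{ABCD}\Sigma_0^{CD}+\tfrac{\Lambda}{3}\sigma_{AB},\qquad \sigma^{(AB}\wedge\Sigma_0^{CD)}=0 .$$ Let $W$ be any set of linearized solutions (the admitted states; $W$ may consist of all of them). A solution $h=(\sigma,\gamma)$ is *anti-self-dual (ASD) at $\mathscr I^\pm$ relative to $W$* if $\int_{C_t}\sigma^{AB}\wedge\gamma'_{AB}\to0$ as $C_t\to\mathscr I^\pm$ for every $(\sigma',\gamma')\in W$. For linearized solutions $h_1,h_2$ put $$\langle h_2|h_1\rangle=-\frac{i}{\kappa^2}\int_{\mathscr I^+}\sigma_1^{AB}\wedge\gamma_{2\,AB}:=-\frac{i}{\kappa^2}\lim_{t\to2}\int_{C_t}\sigma_1^{AB}\wedge\gamma_{2\,AB}$$ when the limit exists. The integral $\int_M$ of a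 4-form is understood as the limit of its integrals over $\{s<|x|<t\}$ as $s\to1$, $t\to2$. A linearized solution is *pure gauge* if $\psi=0$ and, for some smooth complex vector field $\xi$ and symmetric smooth functions $\theta_{AB}$ on $M$, $$\sigma^{AB}=\mathcal L_\xi\Sigma_0^{AB}+2\theta^{(A}{}_C\Sigma_0^{B)C},\qquad \gamma_{AB}=\mathcal L_\xi\Gamma_{0\,AB}-D_0\theta_{AB},$$ i.e. it is generated by an infinitesimal diffeomorphism and an infinitesimal rotation of the spin frame. **Proposition.** Let $h_1,h_2\in W$, with $h_1$ ASD at $\mathscr I^-$ relative to $W$. 1. The generating functional $I=\langle h_2|h_1\rangle$ exists if and only if the following bulk integral exists, and then $$\langle h_2|h_1\rangle=\frac{i}{\kappa^2}\int_M\Big(2\,\Sigma_0^{AB}\wedge\gamma_{1\,A}{}^{C}\wedge\gamma_{2\,CB}-\frac{\Lambda}{3}\,\sigma_1^{AB}\wedge\sigma_{2\,AB}\Big).$$ If the integrand is Lebesgue integrable on $M$, both exist, and the right side is the Lebesgue integral over $M$. 2. Suppose also that $h_2$ is ASD at $\mathscr I^+$ relative to $W$. If $h_1$ or $h_2$ is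 pure gauge, the bulk integral exists and vanishes. 3. Suppose again that $h_2$ is ASD at $\mathscr I^+$ relative to $W$. If only $\psi_1=0$ is known, the bulk integral exists and equals $-\frac{3i}{\Lambda\kappa^2}\int_{C_t}\gamma_1^{AB}\wedge\psi_{2\,ABCD}\Sigma_0^{CD}$ for every $t\in(1,2)$; it vanishes if and only if $\int_{C_t}\sigma_2^{AB}\wedge\gamma_{1\,AB}\to0$ at $\mathscr I^-$. If only $\psi_2=0$ is known, the bulk integral exists and equals $+\frac{3i}{\Lambda\kappa^2}\int_{C_t}\gamma_2^{AB}\wedge\psi_{1\,ABCD}\Sigma_0^{CD}$ for every $t\in(1,2)$. -/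

import Mathlib

open scoped ContDiff Topology
open MeasureTheory Filter

noncomputable section

namespace MHV

/-! ### Complex differential forms on the space-time manifold -/

/-- Ambient `ℝ⁴`, with its Euclidean structure used only to describe the manifold
`S³ × (0,1)`; it plays no role as a space-time metric. -/
abbrev E4 : Type := EuclideanSpace ℝ (Fin 4)

/-- Complex-valued alternating `k`-linear forms on the tangent space `ℝ⁴`. -/
abbrev Form (k : ℕ) : Type := E4 [⋀^Fin k]→L[ℝ] ℂ

/-- The standard oriented basis of `ℝ⁴`. -/
def stdVec (i : Fin 4) : E4 := EuclideanSpace.single i 1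

/-- The open shell `s < |x| < t`. -/
def shell (s t : ℝ) : Set E4 := {x | s < ‖x‖ ∧ ‖x‖ < t}

/-- The space-time manifold `M = {1 < |x| < 2}`, diffeomorphic to `S³ × (0,1)` by
`x ↦ (x/|x|, |x| - 1)`. The slices `|x| = t` foliate it; `t → 1` is past infinity and `t → 2` is
future infinity. -/
def spacetime : Set E4 := shell 1 2

/-- The tensor product `v ↦ α (v₁, …, v_k) β (v_{k+1}, …, v_{k+l})`. -/
def tensorForm {k l m : ℕ} (h : k + l = m) (α : Form k) (β : Form l) :
    ContinuousMultilinearMap ℝ (fun _ : Fin m => E4) ℂ where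
  toMultilinearMap :=
    ((LinearMap.mul' ℝ ℂ).compMultilinearMap
      (MultilinearMap.domCoprod α.toMultilinearMap β.toMultilinearMap)).domDomCongr
        (finSumFinEquiv.trans (finCongr h))
  cont := by
    have h1 : Continuous fun v : Fin m → E4 =>
        α (fun i => v (Fin.cast h (Fin.castAdd l i))) *
          β (fun j => v (Fin.cast h (Fin.natAdd k j))) := by
      fun_prop
    exact h1

theorem tensorForm_apply {k l m : ℕ} (h : k + l = m) (α : Form k) (β : Form l)
    (v : Fin m → E4) :
    tensorForm h α β v =
      α (fun i => v (Fin.cast h (Fin.castAdd l i))) *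
        β (fun j => v (Fin.cast h (Fin.natAdd k j))) := rfl

/-- The exterior product, normalised so that
`(α ∧ β)(v) = (k! l!)⁻¹ ∑_π sign(π) α(v_{π 1}, …, v_{π k}) β(v_{π (k+1)}, …, v_{π (k+l)})`. -/
def wedge {k l m : ℕ} (α : Form k) (β : Form l) (h : k + l = m := by omega) : Form m :=
  ((k.factorial : ℝ) * (l.factorial : ℝ))⁻¹ •
    ContinuousMultilinearMap.alternatization (tensorForm h α β)

/-- Contraction of a form with a complex tangent vector `X + iY`. -/
def contract {k : ℕ} (X Y : E4) (α : Form (k + 1)) : Form k :=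
  α.curryLeft X + Complex.I • α.curryLeft Y

/-- The Lie derivative along the complex vector field `X + iY`, by Cartan's formula. -/
def lieDeriv {k : ℕ} (X Y : E4 → E4) (α : E4 → Form (k + 1)) (x : E4) : Form (k + 1) :=
  extDeriv (fun y => contract (X y) (Y y) (α y)) x + contract (X x) (Y x) (extDeriv α x)

/-! ### Integration -/

/-- The integral of a `3`-form over the slice `C_t = {|x| = t}`, oriented as the boundary of
`{|x| < t}`: in terms of the outward unit normal `n` it is
`∫ (n♭ ∧ α)(e₀, e₁, e₂, e₃) dA`, with `dA = t³ dω`, `dω` the surface measure of the unit sphere. -/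
def sliceIntegral (t : ℝ) (α : E4 → Form 3) : ℂ :=
  (t ^ 3 : ℝ) * ∫ n : Metric.sphere (0 : E4) 1,
    ∑ i : Fin 4, ((-1 : ℂ) ^ (i : ℕ)) * (((n : E4) i : ℝ) : ℂ) *
      α (t • (n : E4)) (fun j : Fin 3 => stdVec (i.succAbove j))
    ∂((volume : Measure E4).toSphere)

/-- The density of a `4`-form with respect to the oriented volume `dx⁰ ∧ dx¹ ∧ dx² ∧ dx³`. -/
def density (α : E4 → Form 4) (x : E4) : ℂ := α x stdVec

/-- The (possibly improper) integral of a `4`-form over `M` exists and is `I`: the integrals over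
the regions between two slices converge to `I` as the slices go to past and future infinity. -/
def HasBulkIntegral (α : E4 → Form 4) (I : ℂ) : Prop :=
  Tendsto (fun p : ℝ × ℝ => ∫ x in shell p.1 p.2, density α x)
    (𝓝[>] (1 : ℝ) ×ˢ 𝓝[<] (2 : ℝ)) (𝓝 I)

/-! ### Two-component spinors -/

/-- The antisymmetric spinor `ε^{AB}`, also `ε_{AB}`, with `ε^{01} = ε_{01} = 1`; indices are
raised and lowered by `ξ^A = ε^{AB} ξ_B`, `ξ_B = ξ^A ε_{AB}`. -/
def eps (A B : Fin 2) : ℂ := if A = B then 0 else if A = 0 then 1 else -1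

/-- Two-index spinor-valued `k`-forms. -/
abbrev SpinForm (k : ℕ) : Type := Fin 2 → Fin 2 → E4 → Form k

/-- `α^{AB}` from `α_{AB}`. -/
def raise {k : ℕ} (α : SpinForm k) : SpinForm k :=
  fun A B x => ∑ C, ∑ D, (eps A C * eps B D) • α C D x

/-- `α_{AB}` from `α^{AB}`. -/
def lower {k : ℕ} (α : SpinForm k) : SpinForm k :=
  fun A B x => ∑ C, ∑ D, (eps C A * eps D B) • α C D x

/-- `α^A{}_B` from `α_{AB}`. For symmetric `α` it is also `α_B{}^A`. -/
def mixed {k : ℕ} (α : SpinForm k) : SpinForm k :=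
  fun A B x => ∑ C, eps A C • α C B x

/-- Symmetric in the two indices and smooth on `M`. -/
def IsSymmSmooth {k : ℕ} (α : SpinForm k) : Prop :=
  (∀ A B, α A B = α B A) ∧ ∀ A B, ContDiffOn ℝ ∞ (α A B) spacetime

/-- `2 β^{(A}{}_C ∧ α^{B)C}`, for `β_{AB}` and `α^{AB}`. -/
def spinAct {k l m : ℕ} (β : SpinForm k) (α : SpinForm l) (h : k + l = m := by omega) :
    SpinForm m :=
  fun A B x => ∑ C, (wedge (mixed β A C x) (α B C x) h + wedge (mixed β B C x) (α A C x) h)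

/-- `D α^{AB} = d α^{AB} + 2 Γ^{(A}{}_C ∧ α^{B)C}`. -/
def covDerivUp {k : ℕ} (Γ : SpinForm 1) (α : SpinForm k) : SpinForm (k + 1) :=
  fun A B x => extDeriv (α A B) x + spinAct Γ α (by omega) A B x

/-- `D α_{AB} = d α_{AB} - Γ^C{}_A ∧ α_{CB} - Γ^C{}_B ∧ α_{AC}`. -/
def covDerivDown {k : ℕ} (Γ : SpinForm 1) (α : SpinForm k) : SpinForm (k + 1) :=
  fun A B x => extDeriv (α A B) x
    - ∑ C, (wedge (mixed Γ C A x) (α C B x) (by omega)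
      + wedge (mixed Γ C B x) (α A C x) (by omega))

/-- The curvature `F_{AB} = d Γ_{AB} + Γ_{AC} ∧ Γ^C{}_B` of the connection `D`. -/
def curvature (Γ : SpinForm 1) : SpinForm 2 :=
  fun A B x => extDeriv (Γ A B) x + ∑ C, wedge (Γ A C x) (mixed Γ C B x)

/-- `α^{(AB} ∧ β^{CD)} = 0` on `M`. -/
def SymWedgeZero (α β : SpinForm 2) : Prop :=
  ∀ x ∈ spacetime, ∀ I : Fin 4 → Fin 2,
    ∑ π : Equiv.Perm (Fin 4),
      (wedge (α (I (π 0)) (I (π 1)) x) (β (I (π 2)) (I (π 3)) x) : Form 4) = 0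

/-- `Σ^{AB} ∧ α¹_A{}^C ∧ α²_{CB}`. -/
def cubic (Sig : SpinForm 2) (α₁ α₂ : SpinForm 1) : E4 → Form 4 :=
  fun x => ∑ A, ∑ B, ∑ C,
    wedge (Sig A B x) (wedge (mixed α₁ C A x) (α₂ C B x) : Form 2)

/-- `α^{AB} ∧ β_{AB}`, for `α` with upper and `β` with lower indices. -/
def pair {k l m : ℕ} (α : SpinForm k) (β : SpinForm l) (h : k + l = m := by omega) :
    E4 → Form m :=
  fun x => ∑ A, ∑ B, wedge (α A B x) (β A B x) h

/-- Four-index spinor fields `ψ_{ABCD}`. -/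
abbrev WeylSpinor : Type := Fin 2 → Fin 2 → Fin 2 → Fin 2 → E4 → ℂ

/-- Totally symmetric and smooth on `M`. -/
def IsWeyl (ψ : WeylSpinor) : Prop :=
  (∀ A B C D, ψ A B C D = ψ B A C D ∧ ψ A B C D = ψ A C B D ∧ ψ A B C D = ψ A B D C) ∧
    ∀ A B C D, ContDiffOn ℝ ∞ (ψ A B C D) spacetime

/-- `ψ_{ABCD} Σ^{CD}`. -/
def weylAct (ψ : WeylSpinor) (Sig : SpinForm 2) : SpinForm 2 :=
  fun A B x => ∑ C, ∑ D, ψ A B C D x • Sig C D x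

/-! ### Self-dual backgrounds and linearised solutions -/

/-- The pair `(Σ₀^{AB}, Γ₀_{AB})`. -/
structure Background where
  /-- the `2`-forms `Σ₀^{AB}` -/
  Sig : SpinForm 2
  /-- the connection `1`-forms `Γ₀_{AB}` -/
  Gam : SpinForm 1

/-- `(Σ₀, Γ₀)` solves the field equations with cosmological constant `Λ` and vanishing
anti-self-dual Weyl spinor:
`D Σ₀^{AB} = 0`, `F₀_{AB} = (Λ/3) Σ₀_{AB}`, `Σ₀^{(AB} ∧ Σ₀^{CD)} = 0`. -/
structure Background.IsSelfDual (Λ : ℝ) (b : Background) : Prop where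
  sig_symm_smooth : IsSymmSmooth b.Sig
  gam_symm_smooth : IsSymmSmooth b.Gam
  torsion_free : ∀ x ∈ spacetime, ∀ A B, covDerivUp b.Gam b.Sig A B x = 0
  curv : ∀ x ∈ spacetime, ∀ A B,
    curvature b.Gam A B x = ((Λ / 3 : ℝ) : ℂ) • lower b.Sig A B x
  tetrad : SymWedgeZero b.Sig b.Sig

/-- A perturbation `h = (σ^{AB}, γ_{AB})` with its linearised Weyl spinor `ψ_{ABCD}`. -/
structure State where
  /-- the perturbation `σ^{AB}` of `Σ₀^{AB}` -/
  sig : SpinForm 2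
  /-- the perturbation `γ_{AB}` of `Γ₀_{AB}` -/
  gam : SpinForm 1
  /-- the linearised anti-self-dual Weyl spinor `ψ_{ABCD}` -/
  psi : WeylSpinor

/-- The linearised field equations
`D₀ σ^{AB} = -2 γ^{(A}{}_C ∧ Σ₀^{B)C}`, `D₀ γ_{AB} = ψ_{ABCD} Σ₀^{CD} + (Λ/3) σ_{AB}`,
`σ^{(AB} ∧ Σ₀^{CD)} = 0`. -/
structure State.IsSolution (Λ : ℝ) (b : Background) (h : State) : Prop where
  sig_symm_smooth : IsSymmSmooth h.sig
  gam_symm_smooth : IsSymmSmooth h.gam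
  psi_weyl : IsWeyl h.psi
  torsion : ∀ x ∈ spacetime, ∀ A B,
    covDerivUp b.Gam h.sig A B x = -spinAct h.gam b.Sig (m := 3) (by omega) A B x
  curv : ∀ x ∈ spacetime, ∀ A B,
    covDerivDown b.Gam h.gam A B x =
      weylAct h.psi b.Sig A B x + ((Λ / 3 : ℝ) : ℂ) • lower h.sig A B x
  tetrad : SymWedgeZero h.sig b.Sig

/-- `h` has vanishing linearised anti-self-dual Weyl spinor on `M`. -/
def State.WeylFree (h : State) : Prop :=
  ∀ x ∈ spacetime, ∀ A B C D, h.psi A B C D x = 0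

/-- `h` is pure gauge: the variation of `(Σ₀, Γ₀)` under an infinitesimal diffeomorphism, along a
complex vector field `X + iY`, and an infinitesimal rotation `θ_{AB}` of the spin frame:
`σ = £ Σ₀ + 2 θ^{(A}{}_C Σ₀^{B)C}`, `γ = £ Γ₀ - D₀ θ`, and `ψ = 0`. -/
def State.IsPureGauge (b : Background) (h : State) : Prop :=
  h.WeylFree ∧
  ∃ (X Y : E4 → E4) (θ : SpinForm 0),
    ContDiffOn ℝ ∞ X spacetime ∧ ContDiffOn ℝ ∞ Y spacetime ∧ IsSymmSmooth θ ∧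
    ∀ x ∈ spacetime, ∀ A B,
      h.sig A B x = lieDeriv X Y (b.Sig A B) x + spinAct θ b.Sig (m := 2) (by omega) A B x ∧
      h.gam A B x = lieDeriv X Y (b.Gam A B) x - covDerivDown b.Gam θ A B x

/-! ### Boundary pairings and the bulk expression -/

/-- `∫_{C_t} σ^{AB} ∧ γ_{AB}` with `σ` from `h` and `γ` from `k`. -/
def slicePairing (t : ℝ) (h k : State) : ℂ :=
  sliceIntegral t (pair h.sig k.gam)

/-- The inner product `⟨h|k⟩ = -(i/κ²) ∫_{C_t} σ_k^{AB} ∧ γ_{h AB}` on the slice `C_t`. -/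
def inner (κ t : ℝ) (h k : State) : ℂ :=
  -(Complex.I / (κ : ℂ) ^ 2) * slicePairing t k h

/-- The generating functional `⟨h|k⟩` at future infinity exists and is `I`. -/
def HasAmplitude (κ : ℝ) (h k : State) (I : ℂ) : Prop :=
  Tendsto (fun t => inner κ t h k) (𝓝[<] (2 : ℝ)) (𝓝 I)

/-- `h` is anti-self-dual at past infinity, relative to the space `W` of test states. -/
def IsASDPast (W : Set State) (h : State) : Prop :=
  ∀ k ∈ W, Tendsto (fun t => slicePairing t h k) (𝓝[>] (1 : ℝ)) (𝓝 0)

/-- `h` is anti-self-dual at future infinity, relative to the space `W` of test states. -/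
def IsASDFuture (W : Set State) (h : State) : Prop :=
  ∀ k ∈ W, Tendsto (fun t => slicePairing t h k) (𝓝[<] (2 : ℝ)) (𝓝 0)

/-- The `4`-form
`(i/κ²) (2 Σ₀^{AB} ∧ γ₁_A{}^C ∧ γ₂_{CB} - (Λ/3) σ₁^{AB} ∧ σ₂_{AB})`. -/
def bulkForm (κ Λ : ℝ) (b : Background) (h₁ h₂ : State) : E4 → Form 4 :=
  fun x => (Complex.I / (κ : ℂ) ^ 2) •
    ((2 : ℂ) • cubic b.Sig h₁.gam h₂.gam x
      - ((Λ / 3 : ℝ) : ℂ) • pair h₁.sig (lower h₂.sig) (m := 4) (by omega) x)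

/-- The flux `∫_{C_t} γ_h^{AB} ∧ ψ_{k ABCD} Σ₀^{CD}`. -/
def weylFlux (b : Background) (t : ℝ) (h k : State) : ℂ :=
  sliceIntegral t (pair (raise h.gam) (weylAct k.psi b.Sig))

end MHV

end

/-!
Up to the factor `-i/κ²`, the bulk integrand is `d(σ₁^{AB} ∧ γ₂_{AB})`: the torsion equation of `h₁`
gives the cubic term, the curvature equation of `h₂` gives the `Λ`-term, and the `ψ₂`-term drops
out because `ψ₂` is totally symmetric while `σ₁^{(AB} ∧ Σ₀^{CD)} = 0`. Stokes' theorem on the shell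
`s < |x| < t`, together with the vanishing of the flux at past infinity, proves the first part.

The bulk integrand is symmetric in `h₁` and `h₂`, so the current
`σ₁^{AB} ∧ γ₂_{AB} - σ₂^{AB} ∧ γ₁_{AB}` is conserved, and the asymptotic conditions identify the
bulk integral with `-i/κ²` times its flux through any slice. Eliminating `σ` by the curvature
equations, `Λ/3` times this current is
`d(γ₁^{AB} ∧ γ₂_{AB}) + γ₁^{AB} ∧ ψ₂_{ABCD} Σ₀^{CD} - γ₂^{AB} ∧ ψ₁_{ABCD} Σ₀^{CD}`, and the exact
term has no flux because slices are closed. Finally, if `h₁` is generated by `ξ` and `θ`,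
then `γ₁ = (Λ/3) ι_ξ Σ₀ - D₀(θ - ι_ξ Γ₀)`; since `D₀(ψ₂ Σ₀) = 0` and contracting
`ψ₂_{ABCD} Σ₀^{AB} ∧ Σ₀^{CD} = 0` with `ξ` kills the first term, the remaining Weyl flux is exact.
-/

noncomputable section

namespace MHV

open scoped InnerProductSpace

/-! ### The exterior algebra and the exterior derivative -/

open Equiv.Perm in
theorem bijective_decomposeFin_mul_cycleRange (n : ℕ) :
    Function.Bijective fun q : Fin (n + 1) × Equiv.Perm (Fin n) =>
      decomposeFin.symm (0, q.2) * q.1.cycleRange := by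
  rw [Fintype.bijective_iff_injective_and_card]
  refine ⟨fun ⟨p, σ⟩ ⟨q, τ⟩ hστ => ?_, by simp [Fintype.card_perm, Nat.factorial_succ]⟩
  dsimp only at hστ
  have apply_self (r : Fin (n + 1)) (ρ : Equiv.Perm (Fin n)) :
      (decomposeFin.symm (0, ρ) * r.cycleRange) r = 0 := by simp
  obtain rfl : p = q := Equiv.injective _ <|
    (apply_self p σ).trans ((apply_self q τ).symm.trans congr($hστ.symm q))
  simpa using hστ

open Equiv.Perm in
theorem alternatization_vecCons {R M N : Type*} [CommRing R] [AddCommGroup M] [AddCommGroup N]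
    [Module R M] [Module R N] {n : ℕ} (T : MultilinearMap R (fun _ : Fin (n + 1) => M) N)
    (x : M) (v : Fin n → M) :
    MultilinearMap.alternatization T (Matrix.vecCons x v) =
      ∑ p : Fin (n + 1),
        (-1 : ℤ) ^ (p : ℕ) • MultilinearMap.alternatization (T.curryMid p x) v := by
  have vecCons_comp (p : Fin (n + 1)) (σ : Equiv.Perm (Fin n)) :
      Matrix.vecCons x v ∘ (decomposeFin.symm (0, σ) * p.cycleRange) =
        p.insertNth x (v ∘ σ) := by
    rw [coe_mul, ← Function.comp_assoc, ← Fin.cons_comp_cycleRange]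
    congr 1
    funext i
    cases i using Fin.cases <;> simp [decomposeFin_symm_apply_succ]
  have sign_eq (p : Fin (n + 1)) (σ : Equiv.Perm (Fin n)) :
      ((sign (decomposeFin.symm (0, σ) * p.cycleRange) : ℤˣ) : ℤ) = (-1) ^ (p : ℕ) * sign σ := by
    simp [mul_comm]
  simp only [MultilinearMap.alternatization_apply, Units.smul_def, Finset.smul_sum, smul_smul]
  rw [← (bijective_decomposeFin_mul_cycleRange n).sum_comp, Fintype.sum_prod_type]
  exact Fintype.sum_congr _ _ fun p => Fintype.sum_congr _ _ fun σ =>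
    congr_arg₂ (· • T ·) (sign_eq p σ) (vecCons_comp p σ)

theorem neg_one_pow_smul_map_insertNth {k : ℕ} (α : Form (k + 1)) (p : Fin (k + 1)) (x : E4)
    (v : Fin k → E4) : (-1 : ℤ) ^ (p : ℕ) • α (p.insertNth x v) = α.curryLeft x v :=
  α.toAlternatingMap.neg_one_pow_smul_map_insertNth p x v

theorem neg_one_pow_smul_curryMid_tensorForm_castAdd {k l m : ℕ} (h : k + 1 + l = m + 1)
    (i : Fin (k + 1)) (x : E4) (α : Form (k + 1)) (β : Form l) :
    (-1 : ℤ) ^ (i : ℕ) •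
        (tensorForm h α β).toMultilinearMap.curryMid (Fin.cast h (Fin.castAdd l i)) x =
      (tensorForm (by omega : k + l = m) (α.curryLeft x) β).toMultilinearMap := by
  ext v
  let w := (Fin.cast h (Fin.castAdd l i)).insertNth (α := fun _ => E4) x v
  have left : (fun a => w (Fin.cast h (Fin.castAdd l a))) =
      i.insertNth x fun a => v (Fin.cast (by omega) (Fin.castAdd l a)) := by
    refine Fin.eq_insertNth_iff.2 ⟨Fin.insertNth_apply_same .., funext fun a => ?_⟩
    have succAbove_eq : Fin.cast h (Fin.castAdd l (i.succAbove a)) =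
        (Fin.cast h (Fin.castAdd l i)).succAbove (Fin.cast (by omega) (Fin.castAdd l a)) := by
      ext; grind [Fin.succAbove, Fin.lt_def]
    exact (congrArg w succAbove_eq).trans (Fin.insertNth_apply_succAbove ..)
  have right : (fun b => w (Fin.cast h (Fin.natAdd (k + 1) b))) =
      fun b => v (Fin.cast (by omega) (Fin.natAdd k b)) := funext fun b => by
    have succAbove_eq : Fin.cast h (Fin.natAdd (k + 1) b) =
        (Fin.cast h (Fin.castAdd l i)).succAbove (Fin.cast (by omega) (Fin.natAdd k b)) := by
      ext; grind [Fin.succAbove, Fin.lt_def]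
    exact (congrArg w succAbove_eq).trans (Fin.insertNth_apply_succAbove ..)
  change (-1 : ℤ) ^ (i : ℕ) • tensorForm h α β w = _
  rw [tensorForm_apply, left, right, ← smul_mul_assoc, neg_one_pow_smul_map_insertNth]
  rfl

theorem neg_one_pow_smul_curryMid_tensorForm_natAdd {k l m : ℕ} (h : k + (l + 1) = m + 1)
    (j : Fin (l + 1)) (x : E4) (α : Form k) (β : Form (l + 1)) :
    (-1 : ℤ) ^ (j : ℕ) •
        (tensorForm h α β).toMultilinearMap.curryMid (Fin.cast h (Fin.natAdd k j)) x =
      (tensorForm (by omega : k + l = m) α (β.curryLeft x)).toMultilinearMap := by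
  ext v
  let w := (Fin.cast h (Fin.natAdd k j)).insertNth (α := fun _ => E4) x v
  have left : (fun a => w (Fin.cast h (Fin.castAdd (l + 1) a))) =
      fun a => v (Fin.cast (by omega) (Fin.castAdd l a)) := funext fun a => by
    have succAbove_eq : Fin.cast h (Fin.castAdd (l + 1) a) =
        (Fin.cast h (Fin.natAdd k j)).succAbove (Fin.cast (by omega) (Fin.castAdd l a)) := by
      ext; grind [Fin.succAbove, Fin.lt_def]
    exact (congrArg w succAbove_eq).trans (Fin.insertNth_apply_succAbove ..)
  have right : (fun b => w (Fin.cast h (Fin.natAdd k b))) =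
      j.insertNth x fun b => v (Fin.cast (by omega) (Fin.natAdd k b)) := by
    refine Fin.eq_insertNth_iff.2 ⟨Fin.insertNth_apply_same .., funext fun b => ?_⟩
    have succAbove_eq : Fin.cast h (Fin.natAdd k (j.succAbove b)) =
        (Fin.cast h (Fin.natAdd k j)).succAbove (Fin.cast (by omega) (Fin.natAdd k b)) := by
      ext; grind [Fin.succAbove, Fin.lt_def]
    exact (congrArg w succAbove_eq).trans (Fin.insertNth_apply_succAbove ..)
  change (-1 : ℤ) ^ (j : ℕ) • tensorForm h α β w = _
  rw [tensorForm_apply, left, right, ← mul_smul_comm, neg_one_pow_smul_map_insertNth]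
  rfl

theorem factorial_mul_wedge_apply {k l m : ℕ} (h : k + l = m) (α : Form k) (β : Form l)
    (v : Fin m → E4) :
    (k.factorial * l.factorial : ℂ) * wedge α β h v =
      MultilinearMap.alternatization (tensorForm h α β).toMultilinearMap v := by
  have hk : (k.factorial : ℂ) ≠ 0 := by exact_mod_cast k.factorial_ne_zero
  have hl : (l.factorial : ℂ) ≠ 0 := by exact_mod_cast l.factorial_ne_zero
  have alternatization_eq := congr($(ContinuousMultilinearMap.alternatization_apply_toAlternatingMap
    (f := tensorForm h α β)) v)
  rw [← alternatization_eq]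
  simp only [wedge, ContinuousAlternatingMap.smul_apply, Complex.real_smul]
  push_cast
  rw [mul_inv_cancel_left₀ (mul_ne_zero hk hl)]
  rfl

theorem curryLeft_wedge {k l m : ℕ} (h : k + 1 + (l + 1) = m + 1) (α : Form (k + 1))
    (β : Form (l + 1)) (x : E4) :
    (wedge α β h).curryLeft x = wedge (α.curryLeft x) β (by omega) +
      (-1 : ℂ) ^ (k + 1) • wedge α (β.curryLeft x) (by omega) := by
  ext v
  let T (p : Fin (m + 1)) : ℂ := MultilinearMap.alternatization
    ((-1 : ℤ) ^ (p : ℕ) • (tensorForm h α β).toMultilinearMap.curryMid p x) v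
  have left (i : Fin (k + 1)) : T (Fin.cast h (Fin.castAdd (l + 1) i)) =
      (k.factorial * (l + 1).factorial : ℂ) * wedge (α.curryLeft x) β (by omega) v := by
    rw [factorial_mul_wedge_apply, ← neg_one_pow_smul_curryMid_tensorForm_castAdd h i]
    rfl
  have right (j : Fin (l + 1)) : T (Fin.cast h (Fin.natAdd (k + 1) j)) =
      ((k + 1).factorial * l.factorial : ℂ) *
        ((-1 : ℂ) ^ (k + 1) * wedge α (β.curryLeft x) (by omega) v) := by
    rw [mul_left_comm, factorial_mul_wedge_apply, ← neg_one_pow_smul_curryMid_tensorForm_natAdd h j]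
    simp [T, pow_add _ _ (j : ℕ), map_zsmul, mul_assoc]
  have hk : ((k + 1).factorial : ℂ) ≠ 0 := by exact_mod_cast Nat.factorial_ne_zero _
  have hl : ((l + 1).factorial : ℂ) ≠ 0 := by exact_mod_cast Nat.factorial_ne_zero _
  apply mul_left_cancel₀ (mul_ne_zero hk hl)
  calc ((k + 1).factorial * (l + 1).factorial : ℂ) * wedge α β h (Matrix.vecCons x v)
      = ∑ p, T p := by
        simp only [factorial_mul_wedge_apply, alternatization_vecCons, T, map_zsmul,
          AlternatingMap.smul_apply]
    _ = ∑ i, T (Fin.cast h (Fin.castAdd (l + 1) i)) +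
          ∑ j, T (Fin.cast h (Fin.natAdd (k + 1) j)) := by
        rw [← (finCongr h).sum_comp, Fin.sum_univ_add]; rfl
    _ = _ := by
        simp only [left, right, Nat.factorial_succ, Finset.sum_const, Finset.card_univ,
          Fintype.card_fin, nsmul_eq_mul, ContinuousAlternatingMap.add_apply,
          ContinuousAlternatingMap.smul_apply, smul_eq_mul]
        push_cast
        ring

theorem zeroForm_wedge {k : ℕ} (α : Form 0) (β : Form k) (h : 0 + k = k) :
    wedge α β h = α 0 • β := by
  have tensorForm_eq : (tensorForm h α β).toMultilinearMap =
      ((α 0 • β).toAlternatingMap : MultilinearMap ℝ (fun _ : Fin k => E4) ℂ) := by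
    ext v
    change tensorForm h α β v = α 0 * β v
    rw [tensorForm_apply, Subsingleton.elim (fun i => v (Fin.cast h (Fin.castAdd k i))) 0]
    exact congrArg (α 0 * β ·) (funext fun j => congrArg v (Fin.ext (by simp)))
  ext v
  have hk : (k.factorial : ℂ) ≠ 0 := by exact_mod_cast k.factorial_ne_zero
  have := factorial_mul_wedge_apply h α β v
  rw [tensorForm_eq, AlternatingMap.coe_alternatization] at this
  simpa [hk] using this

theorem wedge_zeroForm {k : ℕ} (α : Form k) (β : Form 0) (h : k + 0 = k) :
    wedge α β h = β 0 • α := by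
  have tensorForm_eq : (tensorForm h α β).toMultilinearMap =
      ((β 0 • α).toAlternatingMap : MultilinearMap ℝ (fun _ : Fin k => E4) ℂ) := by
    ext v
    change tensorForm h α β v = β 0 * α v
    rw [tensorForm_apply, Subsingleton.elim (fun i => v (Fin.cast h (Fin.natAdd k i))) 0, mul_comm]
    rfl
  ext v
  have hk : (k.factorial : ℂ) ≠ 0 := by exact_mod_cast k.factorial_ne_zero
  have := factorial_mul_wedge_apply h α β v
  rw [tensorForm_eq, AlternatingMap.coe_alternatization] at this
  simpa [hk] using this

theorem ext_curryLeft {k : ℕ} {α β : Form (k + 1)} (h : ∀ x, α.curryLeft x = β.curryLeft x) :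
    α = β := by
  ext v
  rw [← Fin.cons_self_tail v]
  exact congr($(h (v 0)) (Fin.tail v))

instance (k : ℕ) : FiniteDimensional ℝ (Form k) :=
  Module.Finite.of_injective
    (ContinuousMultilinearMap.toMultilinearMapLinear (R' := ℝ) (A := ℝ) ∘ₗ
      ContinuousAlternatingMap.toContinuousMultilinearMapLinear (R := ℝ) (A := ℝ) :
        Form k →ₗ[ℝ] MultilinearMap ℝ (fun _ : Fin k => E4) ℂ)
    (ContinuousMultilinearMap.toMultilinearMap_injective.comp
      ContinuousAlternatingMap.toContinuousMultilinearMap_injective)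

instance (k : ℕ) : FiniteDimensional ℂ (Form k) := Module.Finite.of_restrictScalars_finite ℝ ℂ _

section Wedge

variable {k l m : ℕ}

theorem wedge_apply (h : k + l = m) (α : Form k) (β : Form l) (v : Fin m → E4) :
    wedge α β h v = (k.factorial * l.factorial : ℝ)⁻¹ •
      ∑ σ : Equiv.Perm (Fin m), Equiv.Perm.sign σ • tensorForm h α β (v ∘ σ) := by
  simp only [wedge, ContinuousAlternatingMap.smul_apply,
    ContinuousMultilinearMap.alternatization_apply_apply]

/-- The exterior product as a continuous complex bilinear map. -/
def wedgeCLM (h : k + l = m) : Form k →L[ℂ] Form l →L[ℂ] Form m :=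
  LinearMap.toContinuousBilinearMap <| LinearMap.mk₂ ℂ (fun α β => wedge α β h)
    (fun _ _ _ => by
      ext
      simp only [ContinuousAlternatingMap.add_apply, wedge_apply, tensorForm_apply, add_mul,
        smul_add, Finset.sum_add_distrib])
    (fun c _ _ => by
      ext
      simp only [ContinuousAlternatingMap.smul_apply, wedge_apply, tensorForm_apply,
        smul_mul_assoc, smul_comm _ c, ← Finset.smul_sum])
    (fun _ _ _ => by
      ext
      simp only [ContinuousAlternatingMap.add_apply, wedge_apply, tensorForm_apply, mul_add,
        smul_add, Finset.sum_add_distrib])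
    (fun c _ _ => by
      ext
      simp only [ContinuousAlternatingMap.smul_apply, wedge_apply, tensorForm_apply,
        mul_smul_comm, smul_comm _ c, ← Finset.smul_sum])

theorem wedgeCLM_apply (h : k + l = m) (α : Form k) (β : Form l) :
    wedgeCLM h α β = wedge α β h := rfl

theorem add_wedge (h : k + l = m) (α α' : Form k) (β : Form l) :
    wedge (α + α') β h = wedge α β h + wedge α' β h :=
  (wedgeCLM h).map_add₂ α α' β

theorem wedge_add (h : k + l = m) (α : Form k) (β β' : Form l) :
    wedge α (β + β') h = wedge α β h + wedge α β' h :=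
  (wedgeCLM h α).map_add β β'

theorem smul_wedge (h : k + l = m) (c : ℂ) (α : Form k) (β : Form l) :
    wedge (c • α) β h = c • wedge α β h :=
  (wedgeCLM h).map_smul₂ c α β

theorem wedge_smul (h : k + l = m) (c : ℂ) (α : Form k) (β : Form l) :
    wedge α (c • β) h = c • wedge α β h :=
  (wedgeCLM h α).map_smul c β

theorem neg_wedge (h : k + l = m) (α : Form k) (β : Form l) :
    wedge (-α) β h = -wedge α β h :=
  (wedgeCLM h).map_neg₂ α β

theorem wedge_neg (h : k + l = m) (α : Form k) (β : Form l) :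
    wedge α (-β) h = -wedge α β h :=
  (wedgeCLM h α).map_neg β

theorem wedge_sub (h : k + l = m) (α : Form k) (β β' : Form l) :
    wedge α (β - β') h = wedge α β h - wedge α β' h :=
  (wedgeCLM h α).map_sub β β'

theorem wedge_zero (h : k + l = m) (α : Form k) : wedge α (0 : Form l) h = 0 :=
  (wedgeCLM h α).map_zero

theorem sum_wedge {ι : Type*} (s : Finset ι) (h : k + l = m) (α : ι → Form k) (β : Form l) :
    wedge (∑ i ∈ s, α i) β h = ∑ i ∈ s, wedge (α i) β h := by
  simp only [← wedgeCLM_apply, map_sum, sum_apply]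

theorem wedge_sum {ι : Type*} (s : Finset ι) (h : k + l = m) (α : Form k) (β : ι → Form l) :
    wedge α (∑ i ∈ s, β i) h = ∑ i ∈ s, wedge α (β i) h :=
  map_sum (wedgeCLM h α) β s

theorem curryLeft_complex_smul (c : ℂ) (α : Form (k + 1)) (x : E4) :
    (c • α).curryLeft x = c • α.curryLeft x := rfl

theorem wedge_assoc : ∀ {k l m a b n : ℕ} (α : Form k) (β : Form l) (γ : Form m) (hαβ : k + l = a)
    (hβγ : l + m = b) (h : a + m = n) (h' : k + b = n),
    wedge (wedge α β hαβ) γ h = wedge α (wedge β γ hβγ) h'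
  | 0, l, m, _, _, _, α, β, γ, hαβ, hβγ, h, h' => by
    obtain ⟨rfl, rfl⟩ : _ = _ ∧ _ = _ := ⟨hβγ, (Nat.zero_add _).symm.trans hαβ⟩
    obtain rfl := h
    simp only [zeroForm_wedge, smul_wedge]
  | k + 1, 0, m, _, _, _, α, β, γ, hαβ, hβγ, h, h' => by
    obtain ⟨rfl, rfl⟩ : _ = _ ∧ _ = _ := ⟨hαβ, (Nat.zero_add _).symm.trans hβγ⟩
    simp only [zeroForm_wedge, wedge_zeroForm, smul_wedge, wedge_smul]
  | k + 1, l + 1, 0, _, _, _, α, β, γ, hαβ, hβγ, h, h' => by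
    obtain ⟨rfl, rfl⟩ : _ = _ ∧ _ = _ := ⟨hβγ, h⟩
    simp only [wedge_zeroForm, wedge_smul]
  | k + 1, l + 1, m + 1, _, _, _, α, β, γ, hαβ, hβγ, h, h' => by
    obtain rfl : _ = k + 1 + l + 1 := hαβ.symm
    obtain rfl : _ = l + 1 + m + 1 := hβγ.symm
    obtain rfl : _ = k + 1 + l + 1 + m + 1 := h.symm
    refine ext_curryLeft fun x => ?_
    simp only [curryLeft_wedge, add_wedge, wedge_add, smul_wedge, wedge_smul, smul_add, smul_smul]
    rw [wedge_assoc (b := l + 1 + m + 1) (α.curryLeft x) β γ _ (by omega) _ (by omega),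
      wedge_assoc (b := l + 1 + m) α (β.curryLeft x) γ _ (by omega) _ (by omega),
      wedge_assoc (b := l + 1 + m) α β (γ.curryLeft x) _ (by omega) _ (by omega)]
    rw [add_assoc (wedge _ _ _), ← pow_add]
    rfl
  termination_by k l m => k + l + m

theorem wedge_comm_graded : ∀ {k l m : ℕ} (α : Form k) (β : Form l) (h : k + l = m)
    (h' : l + k = m), wedge β α h' = (-1 : ℂ) ^ (k * l) • wedge α β h
  | 0, l, m, α, β, h, h' => by
    obtain rfl : _ = l := h'.symm
    simp only [zeroForm_wedge, wedge_zeroForm, zero_mul, pow_zero, one_smul]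
  | k + 1, 0, m, α, β, h, h' => by
    obtain rfl : _ = k + 1 := h.symm
    simp only [zeroForm_wedge, wedge_zeroForm, mul_zero, pow_zero, one_smul]
  | k + 1, l + 1, m, α, β, h, h' => by
    obtain rfl : m = k + l + 1 + 1 := by omega
    refine ext_curryLeft fun x => ?_
    rw [curryLeft_wedge, curryLeft_complex_smul, curryLeft_wedge,
      wedge_comm_graded (m := k + l + 1) (α.curryLeft x) β (by omega) (by omega),
      wedge_comm_graded (m := k + l + 1) α (β.curryLeft x) (by omega) (by omega),
      add_comm (_ • wedge α _ _)]
    simp only [smul_add, smul_smul, ← pow_add]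
    congr 2
    · ring
    · exact neg_one_pow_congr (by grind)
  termination_by k l => k + l

open ContinuousAlternatingMap (alternatizeUncurryFin alternatizeUncurryFinCLM
  alternatizeUncurryFinCLM_apply alternatizeUncurryFin_apply)

theorem curryLeft_alternatizeUncurryFin_smulRight (f : E4 →L[ℝ] ℝ) (α : Form (k + 1)) (x : E4) :
    (alternatizeUncurryFin (f.smulRight α)).curryLeft x =
      f x • α - alternatizeUncurryFin (f.smulRight (α.curryLeft x)) := by
  ext v
  rw [ContinuousAlternatingMap.curryLeft_apply_apply, alternatizeUncurryFin_apply,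
    Fin.sum_univ_succ, ContinuousAlternatingMap.sub_apply,
    alternatizeUncurryFin_apply, sub_eq_add_neg, ← Finset.sum_neg_distrib]
  congr 1
  · simp
  · refine Fintype.sum_congr _ _ fun i => ?_
    have removeNth_succ : i.succ.removeNth (Matrix.vecCons x v) =
        Matrix.vecCons x (i.removeNth v) := by
      funext j
      cases j using Fin.cases <;> simp [Fin.removeNth]
    simp [pow_succ, removeNth_succ]

/-- The complex `1`-form given by a real covector. -/
def oneForm (f : E4 →L[ℝ] ℝ) : Form 1 :=
  ContinuousAlternatingMap.ofSubsingleton ℝ E4 ℂ 0 (Complex.ofRealCLM ∘L f)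

theorem alternatizeUncurryFin_smulRight (f : E4 →L[ℝ] ℝ) (α : Form k) :
    alternatizeUncurryFin (f.smulRight α) = wedge (oneForm f) α (Nat.add_comm 1 k) := by
  induction k with
  | zero =>
    ext v
    rw [wedge_zeroForm, alternatizeUncurryFin_apply, Fin.sum_univ_one]
    simpa [oneForm, mul_comm] using Or.inl (congrArg α (Subsingleton.elim (Fin.tail v) ![]))
  | succ k ih =>
    refine ext_curryLeft fun x => ?_
    have curryLeft_oneForm : (oneForm f).curryLeft x 0 = f x := rfl
    rw [curryLeft_alternatizeUncurryFin_smulRight, curryLeft_wedge, ih, zeroForm_wedge,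
      curryLeft_oneForm, sub_eq_add_neg]
    exact congrArg₂ _ rfl ((congrArg (· • _) (pow_one _)).trans (neg_one_smul ℂ _)).symm

theorem extDeriv_eq_sum_wedge (α : E4 → Form k) (x : E4) :
    extDeriv α x =
      ∑ i, wedge (oneForm (EuclideanSpace.proj i)) (fderiv ℝ α x (stdVec i))
        (Nat.add_comm 1 k) := by
  simp only [← alternatizeUncurryFin_smulRight, ← alternatizeUncurryFinCLM_apply]
  rw [← map_sum]
  refine congrArg (alternatizeUncurryFinCLM ℝ E4 ℂ) (ContinuousLinearMap.ext fun v => ?_)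
  have eq_sum : v = ∑ i, v i • stdVec i := by
    simpa [stdVec] using ((EuclideanSpace.basisFun (Fin 4) ℝ).sum_repr v).symm
  conv_lhs => rw [eq_sum, map_sum]
  simp [map_smul]

theorem hasFDerivAt_wedge (h : k + l = m) {α : E4 → Form k} {β : E4 → Form l} {x : E4}
    (hα : DifferentiableAt ℝ α x) (hβ : DifferentiableAt ℝ β x) :
    HasFDerivAt (fun y => wedge (α y) (β y) h)
      (((wedgeCLM h).bilinearRestrictScalars ℝ).precompR E4 (α x) (fderiv ℝ β x) +
        ((wedgeCLM h).bilinearRestrictScalars ℝ).precompL E4 (fderiv ℝ α x) (β x)) x :=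
  ((wedgeCLM h).bilinearRestrictScalars ℝ).hasFDerivAt_of_bilinear hα.hasFDerivAt hβ.hasFDerivAt

theorem fderiv_wedge_apply (h : k + l = m) {α : E4 → Form k} {β : E4 → Form l} {x : E4}
    (hα : DifferentiableAt ℝ α x) (hβ : DifferentiableAt ℝ β x) (v : E4) :
    fderiv ℝ (fun y => wedge (α y) (β y) h) x v =
      wedge (fderiv ℝ α x v) (β x) h + wedge (α x) (fderiv ℝ β x v) h :=
  congr($((hasFDerivAt_wedge h hα hβ).fderiv) v).trans (add_comm _ _)

theorem contDiffOn_wedge (h : k + l = m) {α : E4 → Form k} {β : E4 → Form l}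
    {s : Set E4} {n : WithTop ℕ∞} (hα : ContDiffOn ℝ n α s) (hβ : ContDiffOn ℝ n β s) :
    ContDiffOn ℝ n (fun x => wedge (α x) (β x) h) s :=
  ((wedgeCLM h).bilinearRestrictScalars ℝ).isBoundedBilinearMap.contDiff.comp₂_contDiffOn hα hβ

theorem extDeriv_wedge (h : k + l = m) {α : E4 → Form k} {β : E4 → Form l} {x : E4}
    (hα : DifferentiableAt ℝ α x) (hβ : DifferentiableAt ℝ β x) :
    extDeriv (fun y => wedge (α y) (β y) h) x =
      wedge (extDeriv α x) (β x) (by omega) +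
        (-1 : ℂ) ^ k • wedge (α x) (extDeriv β x) (by omega) := by
  simp only [extDeriv_eq_sum_wedge, fderiv_wedge_apply h hα hβ, wedge_add, sum_wedge, wedge_sum,
    Finset.sum_add_distrib, Finset.smul_sum]
  congr 1 <;> refine Fintype.sum_congr _ _ fun i => ?_
  · exact (wedge_assoc ..).symm
  · rw [← wedge_assoc (a := k + 1) _ _ _ (by omega) _ (by omega),
     ← wedge_assoc (a := k + 1) _ _ _ (by omega) _ (by omega),
     wedge_comm_graded (m := k + 1) (α x) (oneForm _) (by omega) (by omega), mul_one, smul_wedge]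

theorem contDiffOn_extDeriv {α : E4 → Form k} {s : Set E4} (hs : IsOpen s)
    (hα : ContDiffOn ℝ ∞ α s) : ContDiffOn ℝ ∞ (extDeriv α) s :=
  (alternatizeUncurryFinCLM ℝ E4 ℂ).contDiff.comp_contDiffOn
    (hα.fderiv_of_isOpen hs (by simp))

theorem extDeriv_complex_smul {α : E4 → Form k} {x : E4} (c : ℂ)
    (hα : DifferentiableAt ℝ α x) :
    extDeriv (fun y => c • α y) x = c • extDeriv α x := by
  simp only [extDeriv_eq_sum_wedge, fderiv_fun_const_smul hα, FunLike.coe_smul,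
    Pi.smul_apply, wedge_smul, Finset.smul_sum]

theorem extDeriv_fun_sum {ι : Type*} (s : Finset ι) {α : ι → E4 → Form k} {x : E4}
    (hα : ∀ i ∈ s, DifferentiableAt ℝ (α i) x) :
    extDeriv (fun y => ∑ i ∈ s, α i y) x = ∑ i ∈ s, extDeriv (α i) x := by
  simp only [extDeriv, fderiv_fun_sum hα, ← alternatizeUncurryFinCLM_apply, map_sum]

end Wedge

/-! ### Spinor calculus -/

section SpinorAlgebra

variable {k l m : ℕ}

theorem mixed_zero (α : SpinForm k) (B : Fin 2) (x : E4) : mixed α 0 B x = α 1 B x := by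
  ext
  simp [mixed, eps]

theorem mixed_one (α : SpinForm k) (B : Fin 2) (x : E4) : mixed α 1 B x = -α 0 B x := by
  ext
  simp [mixed, eps]

theorem raise_zero_zero (α : SpinForm k) (x : E4) : raise α 0 0 x = α 1 1 x := by
  ext
  simp [raise, eps]

theorem raise_zero_one (α : SpinForm k) (x : E4) : raise α 0 1 x = -α 1 0 x := by
  ext
  simp [raise, eps]

theorem raise_one_zero (α : SpinForm k) (x : E4) : raise α 1 0 x = -α 0 1 x := by
  ext
  simp [raise, eps]

theorem raise_one_one (α : SpinForm k) (x : E4) : raise α 1 1 x = α 0 0 x := by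
  ext
  simp [raise, eps]

theorem lower_eq_raise (α : SpinForm k) : lower α = raise α := by
  have eps_mul_eps (A B C D : Fin 2) : eps C A * eps D B = eps A C * eps B D := by
    fin_cases A <;> fin_cases B <;> fin_cases C <;> fin_cases D <;> simp [eps]
  funext A B x
  simp only [lower, raise, eps_mul_eps]

theorem raise_raise (α : SpinForm k) : raise (raise α) = α := by
  funext A B x
  fin_cases A <;> fin_cases B <;>
    simp only [Fin.zero_eta, Fin.mk_one, raise_zero_zero, raise_zero_one, raise_one_zero,
      raise_one_one, neg_neg]

theorem raise_symm {α : SpinForm k} (hα : ∀ A B, α A B = α B A) (A B : Fin 2) :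
    raise α A B = raise α B A := by
  funext x
  fin_cases A <;> fin_cases B <;> simp [raise_zero_one, raise_one_zero, hα 1 0]

theorem pair_raise_comm (α : SpinForm k) (β : SpinForm l) (h : k + l = m) (h' : l + k = m) :
    pair (raise β) α h' = fun x => (-1 : ℂ) ^ (k * l) • pair (raise α) β h x := by
  funext x
  simp only [pair, Fin.sum_univ_two, raise_zero_zero, raise_zero_one, raise_one_zero,
    raise_one_one, neg_wedge, wedge_comm_graded _ (β _ _ x) h h']
  module

theorem wedge_wedge_comm {n : ℕ} (α : Form k) (β : Form l) (γ : Form m) {a b : ℕ}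
    (hαβ : k + l = a) (hβγ : k + m = b) (h : a + m = n) (h' : l + b = n) :
    wedge β (wedge α γ hβγ) h' = (-1 : ℂ) ^ (k * l) • wedge (wedge α β hαβ) γ h := by
  rw [← smul_wedge, ← wedge_comm_graded α β hαβ (by omega), wedge_assoc]

theorem pair_spinAct {Sig : SpinForm 2} {γ γ' : SpinForm 1} (hS : ∀ A B, Sig A B = Sig B A)
    (hγ' : ∀ A B, γ' A B = γ' B A) (x : E4) :
    pair (spinAct γ Sig) γ' rfl x = (2 : ℂ) • cubic Sig γ γ' x := by
  have reorder (α : Form 2) (β β' : Form 1) :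
      (wedge (wedge β α : Form 3) β' : Form 4) = wedge α (wedge β β' : Form 2) := by
    rw [wedge_wedge_comm β α β' rfl rfl rfl rfl]
    module
  simp only [pair, spinAct, cubic, Fin.sum_univ_two, add_wedge, reorder, hS 1 0, hγ' 1 0]
  module

theorem lower_spinAct {Sig : SpinForm 2} {γ : SpinForm 1} (hS : ∀ A B, Sig A B = Sig B A)
    (hγ : ∀ A B, γ A B = γ B A) (A B : Fin 2) (x : E4) :
    lower (spinAct γ Sig (m := 3)) A B x =
      ∑ C, ((wedge (mixed (lower Sig) C A x) (γ C B x) : Form 3) +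
        wedge (mixed (lower Sig) C B x) (γ A C x)) := by
  have comm (α : Form 2) (β : Form 1) : (wedge β α : Form 3) = wedge α β := by
    rw [wedge_comm_graded α β (by omega)]
    module
  fin_cases A <;> fin_cases B <;>
    simp only [Fin.zero_eta, Fin.mk_one, Fin.sum_univ_two, spinAct, lower_eq_raise, mixed_zero,
      mixed_one, raise_zero_zero, raise_zero_one, raise_one_zero, raise_one_one, neg_wedge,
      wedge_neg, comm, hS 1 0, hγ 1 0] <;>
    module

theorem covDerivUp_raise {Γ : SpinForm 1} {α : SpinForm k} {x : E4}
    (hΓ : ∀ A B, Γ A B = Γ B A) (hα : ∀ A B, α A B = α B A)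
    (dα : ∀ A B, DifferentiableAt ℝ (α A B) x) (A B : Fin 2) :
    covDerivUp Γ (raise α) A B x = raise (covDerivDown Γ α) A B x := by
  have extDeriv_raise : extDeriv (raise α A B) x = raise (fun C D => extDeriv (α C D)) A B x := by
    unfold raise
    rw [extDeriv_fun_sum _ fun C _ => DifferentiableAt.fun_sum fun D _ => (dα C D).fun_const_smul _]
    refine Fintype.sum_congr _ _ fun C => ?_
    rw [extDeriv_fun_sum _ fun D _ => (dα C D).fun_const_smul _]
    exact Fintype.sum_congr _ _ fun D => extDeriv_complex_smul _ (dα C D)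
  rw [covDerivUp, extDeriv_raise]
  fin_cases A <;> fin_cases B <;>
  · simp only [Fin.zero_eta, Fin.mk_one, Fin.sum_univ_two, spinAct, covDerivDown, mixed_zero,
      mixed_one, raise_zero_zero, raise_zero_one, raise_one_zero, raise_one_one, neg_wedge,
      wedge_neg, hΓ 1 0, hα 1 0]
    module

theorem extDeriv_pair {Γ : SpinForm 1} {α : SpinForm k} {β : SpinForm l} {x : E4} (h : k + l = m)
    (hα : ∀ A B, α A B = α B A)
    (dα : ∀ A B, DifferentiableAt ℝ (α A B) x) (dβ : ∀ A B, DifferentiableAt ℝ (β A B) x) :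
    extDeriv (pair α β h) x =
      pair (covDerivUp Γ α) β (by omega) x +
        (-1 : ℂ) ^ k • pair α (covDerivDown Γ β) (by omega) x := by
  have dαβ (A B : Fin 2) : DifferentiableAt ℝ (fun y => wedge (α A B y) (β A B y) h) x :=
    (hasFDerivAt_wedge h (dα A B) (dβ A B)).differentiableAt
  have pass (A B C D E F : Fin 2) :
      wedge (α A B x) (wedge (mixed Γ C D x) (β E F x) (Nat.add_comm 1 l))
          (show _ = m + 1 by omega) =
        (-1 : ℂ) ^ k • wedge (wedge (mixed Γ C D x) (α A B x) (Nat.add_comm 1 k)) (β E F x)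
          (show _ = m + 1 by omega) := by
    rw [wedge_wedge_comm (mixed Γ C D x) (α A B x) (β E F x), one_mul]
  have sign_sq : (-1 : ℂ) ^ k * (-1) ^ k = 1 := by rw [← mul_pow]; norm_num
  unfold pair
  rw [extDeriv_fun_sum _ fun A _ => .fun_sum fun B _ => dαβ A B]
  simp only [extDeriv_fun_sum _ fun B _ => dαβ _ B, extDeriv_wedge h (dα _ _) (dβ _ _)]
  simp only [covDerivUp, spinAct, covDerivDown, Fin.sum_univ_two, add_wedge, wedge_add,
    sub_eq_add_neg, wedge_neg, pass, smul_add, smul_neg, smul_smul, sign_sq, hα 1 0]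
  module

theorem extDeriv_fun_sub {α β : E4 → Form k} {x : E4} (hα : DifferentiableAt ℝ α x)
    (hβ : DifferentiableAt ℝ β x) :
    extDeriv (fun y => α y - β y) x = extDeriv α x - extDeriv β x := by
  simp only [extDeriv, fderiv_fun_sub hα hβ,
    ← ContinuousAlternatingMap.alternatizeUncurryFinCLM_apply, map_sub]

theorem differentiableAt_extDeriv {α : E4 → Form k} {x : E4} (hα : ContDiffAt ℝ 2 α x) :
    DifferentiableAt ℝ (extDeriv α) x :=
  (ContinuousAlternatingMap.alternatizeUncurryFinCLM ℝ E4 ℂ).differentiableAt.comp x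
    ((hα.fderiv_right (m := 1) (by norm_num)).differentiableAt one_ne_zero)

theorem extDeriv_mixed {α : SpinForm k} {x : E4} (dα : ∀ A B, DifferentiableAt ℝ (α A B) x)
    (A B : Fin 2) : extDeriv (mixed α A B) x = mixed (fun C D => extDeriv (α C D)) A B x := by
  unfold mixed
  rw [extDeriv_fun_sum _ fun C _ => (dα C B).fun_const_smul _]
  exact Fintype.sum_congr _ _ fun C => extDeriv_complex_smul _ (dα C B)

theorem mixed_curvature {Γ : SpinForm 1} {x : E4} (dΓ : ∀ A B, DifferentiableAt ℝ (Γ A B) x)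
    (A B : Fin 2) :
    mixed (curvature Γ) A B x =
      extDeriv (mixed Γ A B) x + ∑ C, wedge (mixed Γ A C x) (mixed Γ C B x) := by
  rw [extDeriv_mixed dΓ]
  fin_cases A
  · simp only [Fin.zero_eta, Fin.sum_univ_two, mixed_zero, mixed_one, curvature]
  · simp only [Fin.mk_one, Fin.sum_univ_two, mixed_zero, mixed_one, curvature, neg_wedge]
    module

theorem extDeriv_covDerivDown {Γ : SpinForm 1} {α : SpinForm k} {x : E4}
    (hΓ : ∀ A B, DifferentiableAt ℝ (Γ A B) x) (hα : ∀ A B, ContDiffAt ℝ 2 (α A B) x)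
    (A B : Fin 2) :
    extDeriv (covDerivDown Γ α A B) x =
      -∑ C, (wedge (extDeriv (mixed Γ C A) x) (α C B x) (by omega)
          - wedge (mixed Γ C A x) (extDeriv (α C B) x) (by omega)
        + (wedge (extDeriv (mixed Γ C B) x) (α A C x) (by omega)
          - wedge (mixed Γ C B x) (extDeriv (α A C) x) (by omega))) := by
  have dα (C D : Fin 2) : DifferentiableAt ℝ (α C D) x := (hα C D).differentiableAt (by norm_num)
  have dmixed (C D : Fin 2) : DifferentiableAt ℝ (mixed Γ C D) x :=
    .fun_sum fun E _ => (hΓ E D).fun_const_smul _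
  have dwedge (C D E F : Fin 2) : DifferentiableAt ℝ
      (fun y => wedge (mixed Γ C D y) (α E F y) (Nat.add_comm 1 k)) x :=
    (hasFDerivAt_wedge _ (dmixed C D) (dα E F)).differentiableAt
  have d_dα : extDeriv (extDeriv (α A B)) x = 0 :=
    extDeriv_extDeriv_apply (hα A B) (minSmoothness_of_isRCLikeNormedField).le
  have diff_dα : DifferentiableAt ℝ (extDeriv (α A B)) x :=
    differentiableAt_extDeriv (hα A B)
  unfold covDerivDown
  rw [extDeriv_fun_sub diff_dα (.fun_sum fun C _ => (dwedge C A C B).fun_add (dwedge C B A C)),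
    d_dα, extDeriv_fun_sum _ fun C _ => (dwedge C A C B).fun_add (dwedge C B A C), zero_sub]
  refine congrArg _ (Fintype.sum_congr _ _ fun C => ?_)
  rw [extDeriv_fun_add (dwedge C A C B) (dwedge C B A C), extDeriv_wedge _ (dmixed C A) (dα C B),
    extDeriv_wedge _ (dmixed C B) (dα A C)]
  module

theorem covDerivDown_covDerivDown {Γ : SpinForm 1} {α : SpinForm k} {x : E4}
    (hΓ : ∀ A B, DifferentiableAt ℝ (Γ A B) x) (hα : ∀ A B, ContDiffAt ℝ 2 (α A B) x)
    (A B : Fin 2) :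
    covDerivDown Γ (covDerivDown Γ α) A B x =
      -∑ C, (wedge (mixed (curvature Γ) C A x) (α C B x) (by omega)
        + wedge (mixed (curvature Γ) C B x) (α A C x) (by omega)) := by
  have anticomm (C D E F G H : Fin 2) :
      wedge (mixed Γ C D x) (wedge (mixed Γ E F x) (α G H x) (Nat.add_comm 1 k))
          (Nat.add_comm 1 (k + 1)) =
        -wedge (mixed Γ E F x) (wedge (mixed Γ C D x) (α G H x) (Nat.add_comm 1 k))
          (Nat.add_comm 1 (k + 1)) := by
    have deg : 1 + 1 + k = k + 1 + 1 := by omega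
    rw [← wedge_assoc _ _ _ rfl _ deg, ← wedge_assoc _ _ _ rfl _ deg,
      wedge_comm_graded (mixed Γ E F x) (mixed Γ C D x) rfl, smul_wedge]
    module
  rw [covDerivDown, extDeriv_covDerivDown hΓ hα]
  simp only [mixed_curvature hΓ, covDerivDown, Fin.sum_univ_two, add_wedge, sub_eq_add_neg,
    wedge_add, wedge_neg, wedge_assoc _ _ (α _ _ x) rfl (Nat.add_comm 1 k)
      (show 2 + k = k + 1 + 1 by omega) (Nat.add_comm 1 (k + 1))]
  linear_combination (norm := module)
    anticomm 0 A 0 0 0 B + anticomm 0 A 1 0 1 B + anticomm 1 A 0 1 0 B + anticomm 1 A 1 1 1 B +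
    anticomm 0 B 0 0 A 0 + anticomm 0 B 1 0 A 1 + anticomm 1 B 0 1 A 0 + anticomm 1 B 1 1 A 1 +
    anticomm 0 A 0 B 0 0 + anticomm 0 A 1 B 0 1 + anticomm 1 A 0 B 1 0 + anticomm 1 A 1 B 1 1

end SpinorAlgebra

/-! ### Contraction with complex vector fields -/

section Contraction

variable {k l m : ℕ}

theorem contract_add (X Y : E4) (α β : Form (k + 1)) :
    contract X Y (α + β) = contract X Y α + contract X Y β := by
  ext
  simp only [contract, ContinuousAlternatingMap.add_apply, ContinuousAlternatingMap.smul_apply,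
    ContinuousAlternatingMap.curryLeft_apply_apply, smul_add]
  abel

theorem contract_smul (X Y : E4) (c : ℂ) (α : Form (k + 1)) :
    contract X Y (c • α) = c • contract X Y α := by
  rw [contract, contract, curryLeft_complex_smul, curryLeft_complex_smul, smul_add, smul_comm c]

theorem contract_sum {κ : Type*} (X Y : E4) (s : Finset κ) (α : κ → Form (k + 1)) :
    contract X Y (∑ i ∈ s, α i) = ∑ i ∈ s, contract X Y (α i) :=
  map_sum (AddMonoidHom.mk' (contract X Y) (contract_add X Y)) α s

theorem contract_wedge (h : k + 1 + (l + 1) = m + 1) (X Y : E4) (α : Form (k + 1))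
    (β : Form (l + 1)) :
    contract X Y (wedge α β h) = wedge (contract X Y α) β (by omega) +
      (-1 : ℂ) ^ (k + 1) • wedge α (contract X Y β) (by omega) := by
  simp only [contract, curryLeft_wedge, add_wedge, wedge_add, smul_wedge, wedge_smul]
  module

theorem contDiffOn_contract {X Y : E4 → E4} {α : E4 → Form (k + 1)} {s : Set E4} {n : WithTop ℕ∞}
    (hX : ContDiffOn ℝ n X s) (hY : ContDiffOn ℝ n Y s) (hα : ContDiffOn ℝ n α s) :
    ContDiffOn ℝ n (fun x => contract (X x) (Y x) (α x)) s := by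
  let curry : Form (k + 1) →L[ℝ] E4 →L[ℝ] Form k :=
    ContinuousAlternatingMap.curryLeftLI.toContinuousLinearMap
  have smooth_curryLeft : ContDiffOn ℝ n (fun x => curry (α x)) s := by fun_prop
  exact (smooth_curryLeft.clm_apply hX).add
    ((smooth_curryLeft.clm_apply hY).const_smul Complex.I)

end Contraction

/-! ### Smooth symmetric spinor fields -/

section SmoothSpinorFields

variable {k l m : ℕ}

theorem isOpen_shell (s t : ℝ) : IsOpen (shell s t) :=
  (isOpen_lt continuous_const continuous_norm).inter (isOpen_lt continuous_norm continuous_const)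

theorem isOpen_spacetime : IsOpen spacetime := isOpen_shell 1 2

theorem IsSymmSmooth.contDiffAt {α : SpinForm k} (hα : IsSymmSmooth α) {x : E4}
    (hx : x ∈ spacetime) (A B : Fin 2) : ContDiffAt ℝ ∞ (α A B) x :=
  (hα.2 A B).contDiffAt (isOpen_spacetime.mem_nhds hx)

theorem IsSymmSmooth.differentiableAt {α : SpinForm k} (hα : IsSymmSmooth α) {x : E4}
    (hx : x ∈ spacetime) (A B : Fin 2) : DifferentiableAt ℝ (α A B) x :=
  (hα.contDiffAt hx A B).differentiableAt (by norm_num)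

theorem IsSymmSmooth.raise {α : SpinForm k} (hα : IsSymmSmooth α) : IsSymmSmooth (raise α) :=
  ⟨raise_symm hα.1, fun _ _ =>
    .sum fun C _ => .sum fun D _ => (hα.2 C D).const_smul _⟩

theorem IsSymmSmooth.covDerivDown {Γ : SpinForm 1} {α : SpinForm k} (hΓ : IsSymmSmooth Γ)
    (hα : IsSymmSmooth α) : IsSymmSmooth (covDerivDown Γ α) := by
  have smooth_mixed (C D : Fin 2) : ContDiffOn ℝ ∞ (mixed Γ C D) spacetime :=
    .sum fun E _ => (hΓ.2 E D).const_smul _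
  refine ⟨fun A B => funext fun x => ?_, fun A B => ?_⟩
  · simp only [MHV.covDerivDown, hα.1 A B, hα.1 A, hα.1 _ B, add_comm]
  · exact (contDiffOn_extDeriv isOpen_spacetime (hα.2 A B)).sub <| .sum fun C _ =>
      (contDiffOn_wedge _ (smooth_mixed C A) (hα.2 C B)).add
        (contDiffOn_wedge _ (smooth_mixed C B) (hα.2 A C))

theorem IsSymmSmooth.weylAct {ψ : WeylSpinor} {Sig : SpinForm 2} (hψ : IsWeyl ψ)
    (hS : IsSymmSmooth Sig) : IsSymmSmooth (weylAct ψ Sig) := by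
  refine ⟨fun A B => funext fun x => ?_, fun A B => ?_⟩
  · simp only [MHV.weylAct, (hψ.1 A B _ _).1]
  · exact .sum fun C _ => .sum fun D _ => (hψ.2 A B C D).smul (hS.2 C D)

theorem contDiffOn_pair {α : SpinForm k} {β : SpinForm l} (h : k + l = m)
    (hα : IsSymmSmooth α) (hβ : IsSymmSmooth β) : ContDiffOn ℝ ∞ (pair α β h) spacetime :=
  .sum fun A _ => .sum fun B _ => contDiffOn_wedge h (hα.2 A B) (hβ.2 A B)

end SmoothSpinorFields

/-! ### Totally symmetric spinors -/

section Weyl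

theorem sum_mul_eq_zero_of_symm {κ R : Type*} [Fintype κ] {n : ℕ} [Field R] [CharZero R]
    (ψ W : (Fin n → κ) → R)
    (hψ : ∀ (π : Equiv.Perm (Fin n)) I, ψ (I ∘ π) = ψ I)
    (hW : ∀ I, ∑ π : Equiv.Perm (Fin n), W (I ∘ π) = 0) : ∑ I, ψ I * W I = 0 := by
  have reindex (π : Equiv.Perm (Fin n)) : ∑ I, ψ I * W I = ∑ I, ψ I * W (I ∘ π) := by
    rw [← (π.symm.arrowCongr (.refl κ)).sum_comp]
    exact Fintype.sum_congr _ _ fun I => congrArg (· * _) (hψ π I)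
  have sum_perm : ∑ _π : Equiv.Perm (Fin n), ∑ I, ψ I * W I = 0 := by
    rw [Fintype.sum_congr _ _ reindex, Finset.sum_comm]
    simp only [← Finset.mul_sum, hW, mul_zero, Finset.sum_const_zero]
  simpa [Fintype.card_perm, Nat.factorial_ne_zero] using sum_perm

theorem sum_fin_four {κ M : Type*} [Fintype κ] [AddCommMonoid M] (F : κ → κ → κ → κ → M) :
    ∑ I : Fin 4 → κ, F (I 0) (I 1) (I 2) (I 3) = ∑ A, ∑ B, ∑ C, ∑ D, F A B C D := by
  have sum_cons (n : ℕ) (G : (Fin (n + 1) → κ) → M) :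
      ∑ I, G I = ∑ A, ∑ J : Fin n → κ, G (Fin.cons A J) := by
    rw [← Fintype.sum_prod_type', ← (Fin.consEquiv fun _ : Fin (n + 1) => κ).sum_comp]
    rfl
  simp only [sum_cons, Fintype.sum_unique]
  rfl

theorem IsWeyl.comp_perm {ψ : WeylSpinor} (hψ : IsWeyl ψ) (x : E4) (π : Equiv.Perm (Fin 4))
    (I : Fin 4 → Fin 2) :
    ψ ((I ∘ π) 0) ((I ∘ π) 1) ((I ∘ π) 2) ((I ∘ π) 3) x = ψ (I 0) (I 1) (I 2) (I 3) x := by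
  have mem_closure : π ∈ Submonoid.closure
      (Set.range fun i : Fin 3 => Equiv.swap i.castSucc i.succ) := by
    rw [Equiv.Perm.mclosure_swap_castSucc_succ]
    trivial
  induction mem_closure using Submonoid.closure_induction generalizing I with
  | mem π hπ =>
    obtain ⟨i, rfl⟩ := hπ
    have adjacent := hψ.1 (I 0) (I 1) (I 2) (I 3)
    fin_cases i
    · exact congrFun adjacent.1.symm x
    · exact congrFun adjacent.2.1.symm x
    · exact congrFun adjacent.2.2.symm x
  | one => rfl
  | mul π ρ _ _ hπ hρ => exact (hρ (I ∘ π)).trans (hπ I)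

theorem IsWeyl.swap_pairs {ψ : WeylSpinor} (hψ : IsWeyl ψ) (A B C D : Fin 2) :
    ψ C D A B = ψ A B C D := by
  rw [(hψ.1 C D A B).2.1, (hψ.1 C A D B).1, (hψ.1 A C D B).2.2, (hψ.1 A C B D).2.1]

theorem pair_weylAct_eq_zero {ψ : WeylSpinor} (hψ : IsWeyl ψ) {α β : SpinForm 2}
    (h : SymWedgeZero α β) {x : E4} (hx : x ∈ spacetime) :
    pair α (weylAct ψ β) rfl x = 0 := by
  ext v
  have contraction := sum_mul_eq_zero_of_symm
    (fun I : Fin 4 → Fin 2 => ψ (I 0) (I 1) (I 2) (I 3) x)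
    (fun I => (wedge (α (I 0) (I 1) x) (β (I 2) (I 3) x) : Form 4) v) (hψ.comp_perm x)
    fun I => by simpa using congr($(h x hx I) v)
  rw [sum_fin_four fun A B C D => ψ A B C D x * (wedge (α A B x) (β C D x) : Form 4) v]
    at contraction
  simp only [pair, weylAct, wedge_sum, wedge_smul, ContinuousAlternatingMap.sum_apply,
    ContinuousAlternatingMap.smul_apply, smul_eq_mul]
  exact contraction

theorem pair_contract_weylAct_eq_zero {ψ : WeylSpinor} (hψ : IsWeyl ψ) {Sig : SpinForm 2}
    (h : SymWedgeZero Sig Sig) {x : E4} (hx : x ∈ spacetime) (X Y : E4) :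
    ∑ A, ∑ B, (wedge (contract X Y (Sig A B x)) (weylAct ψ Sig A B x) : Form 3) = 0 := by
  have swap : ∑ A, ∑ B, (wedge (Sig A B x) (contract X Y (weylAct ψ Sig A B x)) : Form 3) =
      ∑ A, ∑ B, wedge (contract X Y (Sig A B x)) (weylAct ψ Sig A B x) := by
    have comm (A B C D : Fin 2) : (wedge (Sig A B x) (contract X Y (Sig C D x)) : Form 3) =
        wedge (contract X Y (Sig C D x)) (Sig A B x) :=
      (wedge_comm_graded (k := 1) (l := 2) _ _ rfl rfl).trans (by module)
    simp only [weylAct, contract_sum, contract_smul, wedge_sum, wedge_smul, comm]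
    calc
      ∑ A, ∑ B, ∑ C, ∑ D, ψ A B C D x • (wedge (contract X Y (Sig C D x)) (Sig A B x) : Form 3)
      _ = ∑ C, ∑ D, ∑ A, ∑ B,
          ψ A B C D x • wedge (contract X Y (Sig C D x)) (Sig A B x) := by
        simp only [Fin.sum_univ_two]
        abel
      _ = _ := by simp only [hψ.swap_pairs]
  have contract_pair := (congrArg (contract X Y) (pair_weylAct_eq_zero hψ h hx)).trans
    (map_zero (AddMonoidHom.mk' (contract X Y) (contract_add X Y)))
  simp only [pair, contract_sum, contract_wedge, Finset.sum_add_distrib, ← Finset.smul_sum, swap]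
    at contract_pair
  have twice : ∑ A, ∑ B, (wedge (contract X Y (Sig A B x)) (weylAct ψ Sig A B x) : Form 3) +
      (-1 : ℂ) ^ 2 • ∑ A, ∑ B, wedge (contract X Y (Sig A B x)) (weylAct ψ Sig A B x) = 0 :=
    contract_pair
  linear_combination (norm := module) (1 / 2 : ℂ) • twice

end Weyl

/-! ### Identities for linearised solutions -/

section CovariantDerivative

variable {k : ℕ} {Γ : SpinForm 1} {α β : SpinForm k} {x : E4}

theorem covDerivDown_congr (h : ∀ A B, α A B =ᶠ[𝓝 x] β A B) (A B : Fin 2) :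
    covDerivDown Γ α A B x = covDerivDown Γ β A B x := by
  simp only [covDerivDown, (h A B).extDeriv_eq, (h _ _).eq_of_nhds]

theorem covDerivDown_fun_sub (dα : ∀ A B, DifferentiableAt ℝ (α A B) x)
    (dβ : ∀ A B, DifferentiableAt ℝ (β A B) x) (A B : Fin 2) :
    covDerivDown Γ (fun C D y => α C D y - β C D y) A B x =
      covDerivDown Γ α A B x - covDerivDown Γ β A B x := by
  simp only [covDerivDown, extDeriv_fun_sub (dα A B) (dβ A B), wedge_sub, Fin.sum_univ_two]
  abel

theorem covDerivDown_fun_smul (c : ℂ) (dα : ∀ A B, DifferentiableAt ℝ (α A B) x)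
    (A B : Fin 2) :
    covDerivDown Γ (fun C D y => c • α C D y) A B x = c • covDerivDown Γ α A B x := by
  simp only [covDerivDown, extDeriv_complex_smul c (dα A B), wedge_smul, Fin.sum_univ_two]
  module

theorem covDerivDown_raise (hΓ : ∀ A B, Γ A B = Γ B A) (hα : ∀ A B, α A B = α B A)
    (dα : ∀ A B, DifferentiableAt ℝ (raise α A B) x) (A B : Fin 2) :
    covDerivDown Γ (raise α) A B x = raise (covDerivUp Γ α) A B x := by
  have raised (C D : Fin 2) := covDerivUp_raise hΓ (raise_symm hα) dα C D
  rw [raise_raise] at raised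
  calc
    _ = raise (raise (covDerivDown Γ (raise α))) A B x := by rw [raise_raise]
    _ = _ := by simp only [raise, raised]

end CovariantDerivative

section Solutions

variable {Λ : ℝ} {b : Background} {h k : State} {x : E4}

theorem extDeriv_pair_sig_gam (hb : b.IsSelfDual Λ) (hh : h.IsSolution Λ b)
    (hk : k.IsSolution Λ b) (hx : x ∈ spacetime) :
    extDeriv (pair h.sig k.gam (m := 3)) x =
      -((2 : ℂ) • cubic b.Sig h.gam k.gam x -
        ((Λ / 3 : ℝ) : ℂ) • pair h.sig (lower k.sig) (m := 4) rfl x) := by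
  have torsion_term : pair (covDerivUp b.Gam h.sig) k.gam rfl x =
      -((2 : ℂ) • cubic b.Sig h.gam k.gam x) := by
    rw [← pair_spinAct hb.sig_symm_smooth.1 hk.gam_symm_smooth.1]
    simp only [pair, hh.torsion x hx, neg_wedge, Finset.sum_neg_distrib]
  have curvature_term : pair h.sig (covDerivDown b.Gam k.gam) rfl x =
      ((Λ / 3 : ℝ) : ℂ) • pair h.sig (lower k.sig) (m := 4) rfl x := by
    have weyl_term := pair_weylAct_eq_zero hk.psi_weyl hh.tetrad hx
    simp only [pair] at weyl_term
    simp only [pair, hk.curv x hx, wedge_add, wedge_smul, Finset.sum_add_distrib, weyl_term,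
      zero_add, Finset.smul_sum]
  rw [extDeriv_pair rfl hh.sig_symm_smooth.1 (hh.sig_symm_smooth.differentiableAt hx)
    (hk.gam_symm_smooth.differentiableAt hx), torsion_term, curvature_term]
  module

theorem pair_sig_gam_sub_swap (hb : b.IsSelfDual Λ) (hh : h.IsSolution Λ b)
    (hk : k.IsSolution Λ b) (hx : x ∈ spacetime) :
    ((Λ / 3 : ℝ) : ℂ) • (pair h.sig k.gam (m := 3) rfl x - pair k.sig h.gam (m := 3) rfl x) =
      extDeriv (pair (raise h.gam) k.gam (m := 2)) x
        + pair (raise h.gam) (weylAct k.psi b.Sig) (m := 3) rfl x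
        - pair (raise k.gam) (weylAct h.psi b.Sig) (m := 3) rfl x := by
  have curvature_term {u v : State} (hv : v.IsSolution Λ b) :
      pair (raise u.gam) (covDerivDown b.Gam v.gam) (m := 3) rfl x =
        pair (raise u.gam) (weylAct v.psi b.Sig) (m := 3) rfl x +
          ((Λ / 3 : ℝ) : ℂ) • pair v.sig u.gam (m := 3) rfl x := by
    have transpose := congrFun (pair_raise_comm (m := 3) u.gam (raise v.sig) rfl rfl) x
    simp only [raise_raise] at transpose
    rw [transpose]
    simp only [pair, hv.curv x hx, lower_eq_raise, wedge_add, wedge_smul,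
      Finset.sum_add_distrib, ← Finset.smul_sum]
    module
  have leibniz := extDeriv_pair (Γ := b.Gam) (m := 2) rfl hh.gam_symm_smooth.raise.1
    (hh.gam_symm_smooth.raise.differentiableAt hx) (hk.gam_symm_smooth.differentiableAt hx)
  have raised_term : pair (covDerivUp b.Gam (raise h.gam)) k.gam (m := 3) rfl x =
      pair (raise k.gam) (covDerivDown b.Gam h.gam) (m := 3) rfl x := by
    rw [congrFun (pair_raise_comm (m := 3) (covDerivDown b.Gam h.gam) k.gam rfl rfl) x]
    simp only [pair, covDerivUp_raise hb.gam_symm_smooth.1 hh.gam_symm_smooth.1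
      (hh.gam_symm_smooth.differentiableAt hx)]
    module
  rw [leibniz, raised_term, curvature_term hh, curvature_term hk]
  module

theorem covDerivDown_weylAct (hb : b.IsSelfDual Λ) (hh : h.IsSolution Λ b) (hx : x ∈ spacetime)
    (A B : Fin 2) : covDerivDown b.Gam (weylAct h.psi b.Sig) A B x = 0 := by
  set c : ℂ := ((Λ / 3 : ℝ) : ℂ)
  have weylAct_eq (C D : Fin 2) : weylAct h.psi b.Sig C D =ᶠ[𝓝 x]
      fun y => covDerivDown b.Gam h.gam C D y - c • raise h.sig C D y := by
    filter_upwards [isOpen_spacetime.mem_nhds hx] with y hy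
    rw [hh.curv y hy, lower_eq_raise, add_sub_cancel_right]
  have mixed_curvature (C D : Fin 2) :
      mixed (curvature b.Gam) C D x = c • mixed (lower b.Sig) C D x := by
    simp only [mixed, hb.curv x hx, Finset.smul_sum, smul_comm c]
    rfl
  have covDeriv_sig : covDerivDown b.Gam (raise h.sig) A B x =
      -lower (spinAct h.gam b.Sig (m := 3)) A B x := by
    rw [covDerivDown_raise hb.gam_symm_smooth.1 hh.sig_symm_smooth.1
      (hh.sig_symm_smooth.raise.differentiableAt hx), lower_eq_raise]
    simp only [raise, hh.torsion x hx, smul_neg, Finset.sum_neg_distrib]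
  have dσ := hh.sig_symm_smooth.raise.differentiableAt hx
  rw [covDerivDown_congr weylAct_eq,
    covDerivDown_fun_sub
      ((hb.gam_symm_smooth.covDerivDown hh.gam_symm_smooth).differentiableAt hx)
      (fun C D => (dσ C D).fun_const_smul c),
    covDerivDown_fun_smul c dσ, covDeriv_sig,
    lower_spinAct hb.sig_symm_smooth.1 hh.gam_symm_smooth.1,
    covDerivDown_covDerivDown (hb.gam_symm_smooth.differentiableAt hx)
      fun C D => (hh.gam_symm_smooth.contDiffAt hx C D).of_le (by norm_cast)]
  simp only [mixed_curvature, smul_wedge, Fin.sum_univ_two]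
  module

end Solutions

/-! ### Pure gauge perturbations -/

section PureGauge

variable {X Y : E4 → E4} {Γ : SpinForm 1} {θ : SpinForm 0} {x : E4}

/-- The components `ι_ξ Γ_{AB}` of a connection along `ξ = X + iY`. -/
def contractConnection (X Y : E4 → E4) (Γ : SpinForm 1) : SpinForm 0 :=
  fun A B x => contract (k := 0) (X x) (Y x) (Γ A B x)

theorem IsSymmSmooth.contractConnection (hΓ : IsSymmSmooth Γ)
    (hX : ContDiffOn ℝ ∞ X spacetime) (hY : ContDiffOn ℝ ∞ Y spacetime) :
    IsSymmSmooth (contractConnection X Y Γ) :=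
  ⟨fun A B => funext fun x => by simp only [MHV.contractConnection, hΓ.1 A B],
    fun A B => contDiffOn_contract (k := 0) hX hY (hΓ.2 A B)⟩

theorem contract_curvature (hΓ : ∀ A B, Γ A B = Γ B A) (A B : Fin 2) :
    contract (X x) (Y x) (curvature Γ A B x) = contract (X x) (Y x) (extDeriv (Γ A B) x) +
      ∑ C, ((wedge (mixed Γ C A x) (contractConnection X Y Γ C B x) : Form 1) +
        wedge (mixed Γ C B x) (contractConnection X Y Γ A C x)) := by
  have contract_mixed (C D : Fin 2) : contract (k := 0) (X x) (Y x) (mixed Γ C D x) =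
      mixed (contractConnection X Y Γ) C D x := by
    simp only [mixed, contractConnection, contract_sum, contract_smul]
  have contract_quadratic (C : Fin 2) :
      contract (X x) (Y x) (wedge (Γ A C x) (mixed Γ C B x) : Form 2) =
        wedge (mixed Γ C B x) (contractConnection X Y Γ A C x) -
          wedge (Γ A C x) (mixed (contractConnection X Y Γ) C B x) := by
    rw [← contract_mixed, contractConnection, contract_wedge (k := 0) (l := 0) (m := 1) rfl,
      wedge_comm_graded (mixed Γ C B x) (contract (k := 0) (X x) (Y x) (Γ A C x)) rfl rfl]
    module
  rw [curvature, contract_add, contract_sum]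
  simp only [contract_quadratic]
  fin_cases A <;>
  · simp only [Fin.zero_eta, Fin.mk_one, Fin.sum_univ_two, mixed_zero, mixed_one, neg_wedge,
      wedge_neg, hΓ 1 0]
    abel

theorem lieDeriv_eq_contract_curvature_add (hΓ : ∀ A B, Γ A B = Γ B A) (A B : Fin 2) :
    lieDeriv X Y (Γ A B) x = contract (X x) (Y x) (curvature Γ A B x) +
      covDerivDown Γ (contractConnection X Y Γ) A B x := by
  rw [contract_curvature hΓ, lieDeriv, covDerivDown, add_add_sub_cancel]
  exact add_comm _ _

/-- The spin rotation `θ - ι_ξ Γ` left over when the Lie derivative along `ξ = X + iY` is replaced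
by its covariant version. -/
def gaugeParameter (X Y : E4 → E4) (Γ : SpinForm 1) (θ : SpinForm 0) : SpinForm 0 :=
  fun A B x => θ A B x - contractConnection X Y Γ A B x

theorem IsSymmSmooth.gaugeParameter (hΓ : IsSymmSmooth Γ) (hX : ContDiffOn ℝ ∞ X spacetime)
    (hY : ContDiffOn ℝ ∞ Y spacetime) (hθ : IsSymmSmooth θ) :
    IsSymmSmooth (gaugeParameter X Y Γ θ) := by
  have hι := hΓ.contractConnection hX hY
  exact ⟨fun A B => funext fun x => by simp only [MHV.gaugeParameter, hθ.1 A B, hι.1 A B],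
    fun A B => (hθ.2 A B).sub (hι.2 A B)⟩

theorem lieDeriv_sub_covDerivDown (hΓ : IsSymmSmooth Γ) (hX : ContDiffOn ℝ ∞ X spacetime)
    (hY : ContDiffOn ℝ ∞ Y spacetime) (hθ : IsSymmSmooth θ) (hx : x ∈ spacetime) (A B : Fin 2) :
    lieDeriv X Y (Γ A B) x - covDerivDown Γ θ A B x =
      contract (X x) (Y x) (curvature Γ A B x) -
        covDerivDown Γ (gaugeParameter X Y Γ θ) A B x := by
  have covDeriv_sub : covDerivDown Γ (gaugeParameter X Y Γ θ) A B x =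
      covDerivDown Γ θ A B x - covDerivDown Γ (contractConnection X Y Γ) A B x :=
    covDerivDown_fun_sub (hθ.differentiableAt hx)
      ((hΓ.contractConnection hX hY).differentiableAt hx) A B
  rw [lieDeriv_eq_contract_curvature_add hΓ.1, covDeriv_sub]
  abel

variable {Λ : ℝ} {b : Background} {h k : State}

theorem pair_raise_weylAct_of_gauge (hb : b.IsSelfDual Λ) (hk : k.IsSolution Λ b)
    (hX : ContDiffOn ℝ ∞ X spacetime) (hY : ContDiffOn ℝ ∞ Y spacetime) (hθ : IsSymmSmooth θ)
    (hx : x ∈ spacetime)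
    (gauge : ∀ A B, h.gam A B x = lieDeriv X Y (b.Gam A B) x - covDerivDown b.Gam θ A B x) :
    pair (raise h.gam) (weylAct k.psi b.Sig) (m := 3) rfl x =
      -extDeriv (pair (raise (gaugeParameter X Y b.Gam θ)) (weylAct k.psi b.Sig) (m := 2) rfl)
        x := by
  set φ := gaugeParameter X Y b.Gam θ
  have hφ : IsSymmSmooth φ := hb.gam_symm_smooth.gaugeParameter hX hY hθ
  have raise_gam (A B : Fin 2) : raise h.gam A B x =
      ((Λ / 3 : ℝ) : ℂ) • contract (X x) (Y x) (b.Sig A B x) -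
        covDerivUp b.Gam (raise φ) A B x := by
    have gam (C D : Fin 2) : h.gam C D x =
        ((Λ / 3 : ℝ) : ℂ) • contract (X x) (Y x) (raise b.Sig C D x) -
          covDerivDown b.Gam φ C D x := by
      rw [gauge, lieDeriv_sub_covDerivDown hb.gam_symm_smooth hX hY hθ hx, hb.curv x hx,
        lower_eq_raise, contract_smul]
    calc
      raise h.gam A B x
      _ = ((Λ / 3 : ℝ) : ℂ) • contract (X x) (Y x) (raise (raise b.Sig) A B x) -
          raise (covDerivDown b.Gam φ) A B x := by
        simp only [raise, gam, contract_sum, contract_smul, smul_sub, Finset.sum_sub_distrib,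
          Finset.smul_sum, smul_comm ((Λ / 3 : ℝ) : ℂ)]
      _ = _ := by
        rw [raise_raise, covDerivUp_raise hb.gam_symm_smooth.1 hφ.1 (hφ.differentiableAt hx)]
  have leibniz := extDeriv_pair (Γ := b.Gam) (m := 2) rfl hφ.raise.1
    (hφ.raise.differentiableAt hx)
    ((hb.sig_symm_smooth.weylAct hk.psi_weyl).differentiableAt hx)
  have covDeriv_weyl := covDerivDown_weylAct hb hk hx
  have contract_weyl := pair_contract_weylAct_eq_zero hk.psi_weyl hb.tetrad hx (X x) (Y x)
  rw [leibniz]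
  simp only [pair, raise_gam, covDeriv_weyl, sub_eq_add_neg, add_wedge, neg_wedge, smul_wedge,
    Finset.sum_add_distrib, Finset.sum_neg_distrib, ← Finset.smul_sum, contract_weyl,
    smul_zero, wedge_zero, Finset.sum_const_zero, add_zero, zero_add]

end PureGauge

/-! ### The divergence theorem on spherical shells -/

section Sphere

variable {E F : Type*} [NormedAddCommGroup E] [InnerProductSpace ℝ E] [NormedAddCommGroup F]
  [NormedSpace ℝ F]

theorem contDiff_comp_norm {φ : ℝ → ℝ} (hφ : ContDiff ℝ 1 φ) (h0 : φ =ᶠ[𝓝 0] 0) :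
    ContDiff ℝ 1 fun x : E => φ ‖x‖ := by
  refine contDiff_iff_contDiffAt.2 fun x => ?_
  obtain rfl | hx := eq_or_ne x 0
  · have hnorm : Tendsto (fun x : E => ‖x‖) (𝓝 0) (𝓝 0) := tendsto_norm_zero
    exact contDiffAt_const.congr_of_eventuallyEq (hnorm.eventually h0)
  · exact hφ.contDiffAt.comp x (contDiffAt_norm ℝ hx)

theorem hasFDerivAt_norm {x : E} (hx : x ≠ 0) :
    HasFDerivAt (fun y : E => ‖y‖) (‖x‖⁻¹ • innerSL ℝ x) x := by
  have h := (hasStrictFDerivAt_norm_sq x).hasFDerivAt.sqrt (by positivity)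
  simp only [Real.sqrt_sq (norm_nonneg _)] at h
  convert h using 1
  module

theorem fderiv_comp_norm_smul {φ : ℝ → ℝ} {f : E → F} (hφ : Differentiable ℝ φ)
    (hf : Differentiable ℝ f) {r : ℝ} (hr : 0 < r) {n : E} (hn : ‖n‖ = 1) (v : E) :
    fderiv ℝ (fun x => φ ‖x‖ • f x) (r • n) v =
      φ r • fderiv ℝ f (r • n) v + deriv φ r • ⟪n, v⟫_ℝ • f (r • n) := by
  have hnorm : ‖r • n‖ = r := by rw [norm_smul, hn, mul_one, Real.norm_of_nonneg hr.le]
  have hne : r • n ≠ 0 := by rw [← norm_ne_zero_iff, hnorm]; exact hr.ne'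
  have hφn : HasFDerivAt (fun x : E => φ ‖x‖) (deriv φ ‖r • n‖ • ‖r • n‖⁻¹ • innerSL ℝ (r • n))
      (r • n) := (hφ ‖r • n‖).hasDerivAt.comp_hasFDerivAt (r • n) (hasFDerivAt_norm hne)
  rw [(hφn.fun_smul (hf (r • n)).hasFDerivAt).fderiv]
  simp [hnorm, hr.ne', mul_smul]

variable [FiniteDimensional ℝ E] [MeasurableSpace E] [BorelSpace E] {μ : Measure E}
  [μ.IsAddHaarMeasure]

theorem integral_fderiv_eq_zero {f : E → F} (hf : ContDiff ℝ 1 f) (hc : HasCompactSupport f)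
    (v : E) : ∫ x, fderiv ℝ f x v ∂μ = 0 := by
  have hf' : Integrable (fun x => fderiv ℝ f x v) μ :=
    (hf.continuous_fderiv_apply one_ne_zero |>.comp (by fun_prop : Continuous fun x : E => (x, v)))
      |>.integrable_of_hasCompactSupport (hc.fderiv_apply (𝕜 := ℝ) v)
  simpa using integral_smul_fderiv_eq_neg_fderiv_smul_of_integrable (𝕜 := ℝ) (μ := μ)
    (f := fun _ => 1) (g := f) (v := v) (by simp) (by simpa using hf')
    (by simpa using hf.continuous.integrable_of_hasCompactSupport hc)
    (fun _ _ => by fun_prop) (fun x _ => hf.differentiable one_ne_zero x)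

/-- The integral over the sphere of radius `r` about the origin of an integrand depending on the
outward unit normal (first argument) and the point (second argument). -/
def sphereIntegral (μ : Measure E) (f : E → E → F) (r : ℝ) : F :=
  r ^ (Module.finrank ℝ E - 1) •
    ∫ n : Metric.sphere (0 : E) 1, f n (r • (n : E)) ∂μ.toSphere

theorem continuous_sphereIntegral {f : E → E → F} (hf : Continuous (Function.uncurry f)) :
    Continuous (sphereIntegral μ f) := by
  have h : Continuous fun r : ℝ =>
      ∫ n : Metric.sphere (0 : E) 1, f n (r • (n : E)) ∂μ.toSphere := by
    simpa using continuous_parametric_integral_of_continuous (μ := μ.toSphere)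
      (f := fun (r : ℝ) (n : Metric.sphere (0 : E) 1) => f n (r • (n : E)))
      (by simp only [Function.uncurry_def] at hf ⊢; fun_prop) isCompact_univ
  unfold sphereIntegral
  fun_prop

theorem integral_eq_integral_sphereIntegral [Nontrivial E] {g : E → F} (hg : Integrable g μ) :
    ∫ x, g x ∂μ = ∫ r in Set.Ioi (0 : ℝ), sphereIntegral μ (fun _ => g) r := by
  set d := Module.finrank ℝ E - 1
  have polar := μ.measurePreserving_homeomorphUnitSphereProd
  have emb := (homeomorphUnitSphereProd E).measurableEmbedding
  let h : Metric.sphere (0 : E) 1 × Set.Ioi (0 : ℝ) → F := fun p => g ((p.2 : ℝ) • (p.1 : E))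
  have h_comp : h ∘ homeomorphUnitSphereProd E = fun x : ({0}ᶜ : Set E) => g x := by
    funext x
    have hx : (x : E) ≠ 0 := x.2
    simp [h, smul_smul, hx]
  have h_int : Integrable h (μ.toSphere.prod (Measure.volumeIoiPow d)) := by
    rw [← polar.integrable_comp_emb emb, h_comp]
    exact (integrableOn_iff_comap_subtypeVal (measurableSet_singleton _).compl).1 hg.integrableOn
  calc
    ∫ x, g x ∂μ = ∫ x : ({0}ᶜ : Set E), g x ∂(μ.comap Subtype.val) := by
      rw [integral_subtype_comap (measurableSet_singleton _).compl g, restrict_compl_singleton]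
    _ = ∫ p, h p ∂(μ.toSphere.prod (Measure.volumeIoiPow d)) := by
      rw [← polar.integral_comp emb]
      exact congrArg (fun k => ∫ x, k x ∂(μ.comap Subtype.val)) h_comp.symm
    _ = ∫ r : Set.Ioi (0 : ℝ), ∫ n, h (n, r) ∂μ.toSphere ∂(Measure.volumeIoiPow d) :=
      integral_prod_symm _ h_int
    _ = ∫ r in Set.Ioi (0 : ℝ), sphereIntegral μ (fun _ => g) r := by
      simp only [Measure.volumeIoiPow, ENNReal.ofReal]
      rw [integral_withDensity_eq_integral_smul (by fun_prop),
        integral_subtype_comap measurableSet_Ioi fun r => Real.toNNReal (r ^ d) •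
          ∫ n : Metric.sphere (0 : E) 1, g (r • (n : E)) ∂μ.toSphere]
      refine setIntegral_congr_fun measurableSet_Ioi fun r hr => ?_
      simp only [NNReal.smul_def, Real.coe_toNNReal _ (pow_nonneg (le_of_lt hr) d), sphereIntegral,
        d]

theorem setIntegral_norm_preimage_Ioo [Nontrivial E] {g : E → F} {s t : ℝ} (hs : 0 ≤ s)
    (hg : IntegrableOn g (norm ⁻¹' Set.Ioo s t) μ) :
    ∫ x in norm ⁻¹' Set.Ioo s t, g x ∂μ =
      ∫ r in Set.Ioo s t, sphereIntegral μ (fun _ => g) r := by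
  have hm : MeasurableSet ((norm : E → ℝ) ⁻¹' Set.Ioo s t) :=
    measurableSet_Ioo.preimage measurable_norm
  rw [← integral_indicator hm, integral_eq_integral_sphereIntegral (hg.integrable_indicator hm),
    ← integral_indicator measurableSet_Ioi, ← integral_indicator measurableSet_Ioo]
  congr 1
  funext r
  by_cases hr : 0 < r
  · have hnorm (n : Metric.sphere (0 : E) 1) : ‖r • (n : E)‖ = r := by
      rw [norm_smul, norm_eq_of_mem_sphere, mul_one, Real.norm_of_nonneg hr.le]
    by_cases hrst : r ∈ Set.Ioo s t <;> simp [sphereIntegral, hr, hrst, hnorm]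
  · have hrst : r ∉ Set.Ioo s t := fun h => hr (hs.trans_lt h.1)
    simp [hr, hrst]

theorem hasDerivAt_integral_of_continuous {K : Type*} [TopologicalSpace K] [CompactSpace K]
    [MeasurableSpace K] [BorelSpace K] {ν : Measure K} [IsFiniteMeasure ν]
    {f f' : ℝ → K → F} (hf : Continuous (Function.uncurry f))
    (hf' : Continuous (Function.uncurry f')) (hd : ∀ t n, HasDerivAt (f · n) (f' t n) t) (t : ℝ) :
    HasDerivAt (fun t => ∫ n, f t n ∂ν) (∫ n, f' t n ∂ν) t := by
  obtain ⟨C, hC⟩ := ((isCompact_closedBall t 1).prod (isCompact_univ (X := K)))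
    |>.exists_bound_of_continuousOn hf'.continuousOn
  have slice {g : ℝ → K → F} (hg : Continuous (Function.uncurry g)) (s : ℝ) :
      Integrable (g s) ν :=
    (hg.comp (Continuous.prodMk_right s)).integrable_of_hasCompactSupport
      (HasCompactSupport.of_compactSpace _)
  exact (hasDerivAt_integral_of_dominated_loc_of_deriv_le (bound := fun _ => C)
    (Metric.closedBall_mem_nhds t one_pos)
    (.of_forall fun s => (slice hf s).aestronglyMeasurable) (slice hf t)
    (slice hf' t).aestronglyMeasurable (.of_forall fun n s hs => hC (s, n) ⟨hs, trivial⟩)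
    (integrable_const C) (.of_forall fun n s _ => hd s n)).2

theorem contDiff_sphereIntegral {f : E → E → F} {f' : E → E → E →L[ℝ] F}
    (hf : Continuous (Function.uncurry f)) (hf' : Continuous (Function.uncurry f'))
    (hd : ∀ n x, HasFDerivAt (f n) (f' n x) x) : ContDiff ℝ 1 (sphereIntegral μ f) := by
  have hderiv (t : ℝ) : HasDerivAt
      (fun r => ∫ n : Metric.sphere (0 : E) 1, f n (r • (n : E)) ∂μ.toSphere)
      (∫ n : Metric.sphere (0 : E) 1, f' n (t • (n : E)) n ∂μ.toSphere) t := by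
    simp only [Function.uncurry_def] at hf hf'
    refine hasDerivAt_integral_of_continuous
      (f := fun r (n : Metric.sphere (0 : E) 1) => f n (r • (n : E)))
      (f' := fun r (n : Metric.sphere (0 : E) 1) => f' n (r • (n : E)) n)
      (by simp only [Function.uncurry_def]; fun_prop)
      (by simp only [Function.uncurry_def]; fun_prop) (fun t n => ?_) t
    have hline : HasDerivAt (fun r : ℝ => r • (n : E)) (n : E) t := by
      simpa using (hasDerivAt_id t).smul_const (n : E)
    exact (hd n _).comp_hasDerivAt t hline
  refine (contDiff_id.pow _).smul
    (contDiff_one_iff_deriv.2 ⟨fun t => (hderiv t).differentiableAt, ?_⟩)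
  rw [funext fun t => (hderiv t).deriv]
  simpa using continuous_parametric_integral_of_continuous (μ := μ.toSphere)
    (f := fun (r : ℝ) (n : Metric.sphere (0 : E) 1) => f' n (r • (n : E)) n)
    (by simp only [Function.uncurry_def] at hf' ⊢; fun_prop) isCompact_univ

theorem sphereIntegral_sum {ι : Type*} [Fintype ι] {f : ι → E → E → F}
    (hf : ∀ i, Continuous (Function.uncurry (f i))) (r : ℝ) :
    sphereIntegral μ (fun n x => ∑ i, f i n x) r = ∑ i, sphereIntegral μ (f i) r := by
  have hint (i : ι) : Integrable
      (fun n : Metric.sphere (0 : E) 1 => f i n (r • (n : E))) μ.toSphere := by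
    have hi := hf i
    simp only [Function.uncurry_def] at hi
    exact Continuous.integrable_of_hasCompactSupport (by fun_prop)
      (HasCompactSupport.of_compactSpace _)
  simp only [sphereIntegral, integral_finsetSum _ fun i _ => hint i, Finset.smul_sum]

theorem sphereIntegral_add {f g : E → E → F} (hf : Continuous (Function.uncurry f))
    (hg : Continuous (Function.uncurry g)) (r : ℝ) :
    sphereIntegral μ (fun n x => f n x + g n x) r =
      sphereIntegral μ f r + sphereIntegral μ g r := by
  simpa using sphereIntegral_sum (μ := μ) (f := ![f, g]) (by simp [Fin.forall_fin_two, hf, hg]) r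

theorem integral_smul_sphereIntegral_fderiv [Nontrivial E] {f : E → F} (hf : ContDiff ℝ 1 f)
    (v : E) {φ : ℝ → ℝ} (hφ : ContDiff ℝ 1 φ) (hc : HasCompactSupport φ)
    (hs : tsupport φ ⊆ Set.Ioi 0) :
    ∫ r, (φ r • sphereIntegral μ (fun _ x => fderiv ℝ f x v) r +
      deriv φ r • sphereIntegral μ (fun n x => ⟪n, v⟫_ℝ • f x) r) = 0 := by
  have hφ0 {r : ℝ} (hr : r ∉ Set.Ioi (0 : ℝ)) : φ =ᶠ[𝓝 r] 0 :=
    notMem_tsupport_iff_eventuallyEq.1 fun h => hr (hs h)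
  have hφf : ContDiff ℝ 1 fun x => φ ‖x‖ • f x :=
    (contDiff_comp_norm hφ (hφ0 Set.self_notMem_Ioi)).smul hf
  have hcφf : HasCompactSupport fun x => φ ‖x‖ • f x := by
    obtain ⟨R, hR⟩ := hc.isCompact.isBounded.subset_closedBall 0
    refine HasCompactSupport.of_support_subset_isCompact (isCompact_closedBall (0 : E) R)
      fun x hx => ?_
    have hφx : φ ‖x‖ ≠ 0 := fun h => hx (by simp [h])
    simpa using hR (subset_tsupport φ hφx)
  have hint : Integrable (fun x => fderiv ℝ (fun x => φ ‖x‖ • f x) x v) μ :=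
    (hφf.continuous_fderiv one_ne_zero |>.clm_apply continuous_const)
      |>.integrable_of_hasCompactSupport (hcφf.fderiv_apply (𝕜 := ℝ) v)
  rw [← integral_fderiv_eq_zero (μ := μ) hφf hcφf v, integral_eq_integral_sphereIntegral hint,
    ← setIntegral_eq_integral_of_forall_compl_eq_zero (s := Set.Ioi 0)
      fun r hr => by simp [(hφ0 hr).eq_of_nhds, (hφ0 hr).deriv_eq]]
  refine setIntegral_congr_fun measurableSet_Ioi fun r hr => ?_
  have hfc := hf.continuous
  have hsphere (g : E → E → F) (c : ℝ) : c • sphereIntegral μ g r =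
      sphereIntegral μ (fun n x => c • g n x) r := by
    simp only [sphereIntegral, integral_smul, smul_comm c]
  rw [hsphere, hsphere, ← sphereIntegral_add (by fun_prop) (by fun_prop)]
  simp only [sphereIntegral]
  congr! 3 with n
  exact (fderiv_comp_norm_smul (hφ.differentiable one_ne_zero) (hf.differentiable one_ne_zero) hr
    (norm_eq_of_mem_sphere n) v).symm

theorem eqOn_deriv_of_integral_smul_eq_zero [CompleteSpace F] {U : Set ℝ} (hU : IsOpen U)
    {f g : ℝ → F} (hf : ContDiff ℝ 1 f) (hg : Continuous g)
    (h : ∀ φ : ℝ → ℝ, ContDiff ℝ ∞ φ → HasCompactSupport φ → tsupport φ ⊆ U →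
      ∫ r, (φ r • g r + deriv φ r • f r) = 0) : Set.EqOn (deriv f) g U := by
  have hf' : Continuous (deriv f) := hf.continuous_deriv le_rfl
  refine Measure.eqOn_open_of_ae_eq (μ := volume) ?_ hU hf'.continuousOn hg.continuousOn
  refine (ae_restrict_iff' hU.measurableSet).2 ?_
  have key : ∀ᵐ r, r ∈ U → (deriv f - g) r = 0 := by
    refine hU.ae_eq_zero_of_integral_contDiff_smul_eq_zero
      ((hf'.sub hg).locallyIntegrable.locallyIntegrableOn _) fun φ hφ hc hφU => ?_
    have hφ' : Continuous (deriv φ) := hφ.continuous_deriv (by simp)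
    have hint {u : ℝ → F} (hu : Continuous u) : Integrable fun r => φ r • u r :=
      (hφ.continuous.smul hu).integrable_of_hasCompactSupport hc.smul_right
    have hint' : Integrable fun r => deriv φ r • f r :=
      (hφ'.smul hf.continuous).integrable_of_hasCompactSupport hc.deriv.smul_right
    have byParts : ∫ r, (φ r • deriv f r + deriv φ r • f r) = 0 :=
      integral_eq_zero_of_hasDerivAt_of_integrable (f := fun r => φ r • f r)
        (fun r => (hφ.differentiable (by simp) r).hasDerivAt.smul
          (hf.differentiable one_ne_zero r).hasDerivAt)
        ((hint hf').add hint') (hint hf.continuous)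
    have weak := h φ hφ hc hφU
    rw [integral_add (hint hf') hint'] at byParts
    rw [integral_add (hint hg) hint'] at weak
    simp only [Pi.sub_apply, smul_sub]
    rw [integral_sub (hint hf') (hint hg), sub_eq_zero]
    exact add_right_cancel (byParts.trans weak.symm)
  filter_upwards [key] with r hr hrU
  exact sub_eq_zero.1 (hr hrU)

theorem setIntegral_fderiv_norm_preimage_Ioo [Nontrivial E] [CompleteSpace F] {f : E → F}
    (hf : ContDiff ℝ 1 f) (v : E) {s t : ℝ} (hs : 0 ≤ s) (hst : s ≤ t) :
    ∫ x in norm ⁻¹' Set.Ioo s t, fderiv ℝ f x v ∂μ =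
      sphereIntegral μ (fun n x => ⟪n, v⟫_ℝ • f x) t -
        sphereIntegral μ (fun n x => ⟪n, v⟫_ℝ • f x) s := by
  have hfc := hf.continuous
  have hf' := hf.continuous_fderiv one_ne_zero
  have hflux : ContDiff ℝ 1 (sphereIntegral μ fun n x => ⟪n, v⟫_ℝ • f x) :=
    contDiff_sphereIntegral (f' := fun n x => ⟪n, v⟫_ℝ • fderiv ℝ f x) (by fun_prop)
      (by fun_prop) fun n x => (hf.differentiable one_ne_zero x).hasFDerivAt.const_smul _
  have hdiv : Continuous (sphereIntegral μ fun _ x => fderiv ℝ f x v) :=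
    continuous_sphereIntegral (by fun_prop)
  have hderiv := eqOn_deriv_of_integral_smul_eq_zero isOpen_Ioi hflux hdiv fun φ hφ =>
    integral_smul_sphereIntegral_fderiv hf v (hφ.of_le (by simp))
  have hint : IntegrableOn (fun x => fderiv ℝ f x v) (norm ⁻¹' Set.Ioo s t) μ :=
    ((hf'.clm_apply continuous_const).continuousOn.integrableOn_compact
      (isCompact_closedBall (0 : E) t)).mono_set fun x hx => by simpa using hx.2.le
  rw [setIntegral_norm_preimage_Ioo hs hint, ← integral_Ioc_eq_integral_Ioo,
    ← intervalIntegral.integral_of_le hst]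
  exact intervalIntegral.integral_eq_sub_of_hasDerivAt_of_le hst hflux.continuous.continuousOn
    (fun r hr => hderiv (hs.trans_lt hr.1) ▸
      (hflux.differentiable one_ne_zero r).hasDerivAt) (hdiv.intervalIntegrable s t)

end Sphere

/-! ### Stokes' theorem -/

theorem exists_contDiff_eventuallyEq_nhdsSet {E F : Type*} [NormedAddCommGroup E]
    [NormedSpace ℝ E] [FiniteDimensional ℝ E] [NormedAddCommGroup F] [NormedSpace ℝ F]
    {f : E → F} {U K : Set E} (hf : ContDiffOn ℝ ∞ f U) (hU : IsOpen U) (hK : IsClosed K)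
    (hKU : K ⊆ U) : ∃ g : E → F, ContDiff ℝ ∞ g ∧ g =ᶠ[𝓝ˢ K] f := by
  obtain ⟨χ, hχ0, hχ1, -⟩ := exists_contMDiffMap_zero_one_nhds_of_isClosed (n := ⊤)
    (modelWithCornersSelf ℝ E) hU.isClosed_compl hK (Set.disjoint_compl_left_iff_subset.2 hKU)
  refine ⟨fun x => χ x • f x, contDiff_iff_contDiffAt.2 fun x => ?_, ?_⟩
  · by_cases hx : x ∈ U
    · exact χ.contMDiff.contDiff.contDiffAt.smul (hf.contDiffAt (hU.mem_nhds hx))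
    · refine contDiffAt_const (c := 0) |>.congr_of_eventuallyEq ?_
      filter_upwards [hχ0.filter_mono (nhds_le_nhdsSet hx)] with y hy
      rw [hy, zero_smul]
  · filter_upwards [hχ1] with x hx
    rw [hx, one_smul]

/-- The `i`-th component of the vector field `V` with `α = ι_V vol`, for a `3`-form `α` on `ℝ⁴`. -/
def dualComponent (i : Fin 4) : Form 3 →L[ℝ] ℂ :=
  (-1 : ℂ) ^ (i : ℕ) • ContinuousAlternatingMap.apply ℝ E4 ℂ fun j => stdVec (i.succAbove j)

/-- `fluxDensity n α = (n♭ ∧ α)(e₀, e₁, e₂, e₃)`, the integrand of the flux of a `3`-form through a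
hypersurface with unit normal `n`. -/
def fluxDensity (n : E4) (α : Form 3) : ℂ :=
  ∑ i, ⟪n, stdVec i⟫_ℝ • dualComponent i α

theorem fluxDensity_add (n : E4) (α β : Form 3) :
    fluxDensity n (α + β) = fluxDensity n α + fluxDensity n β := by
  simp only [fluxDensity, map_add, smul_add, Finset.sum_add_distrib]

theorem fluxDensity_smul (n : E4) (c : ℂ) (α : Form 3) :
    fluxDensity n (c • α) = c * fluxDensity n α := by
  simp [fluxDensity, dualComponent, Finset.mul_sum, mul_left_comm c]

theorem sliceIntegral_eq_sphereIntegral (t : ℝ) (α : E4 → Form 3) :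
    sliceIntegral t α = sphereIntegral volume (fun n x => fluxDensity n (α x)) t := by
  rw [sliceIntegral, sphereIntegral, Complex.real_smul]
  simp only [finrank_euclideanSpace, Fintype.card_fin, Nat.add_one_sub_one]
  congr! 4 with n
  simp [fluxDensity, dualComponent, stdVec, EuclideanSpace.inner_single_right, mul_assoc,
    mul_left_comm]

theorem density_extDeriv {α : E4 → Form 3} {x : E4} (hα : DifferentiableAt ℝ α x) :
    density (extDeriv α) x =
      ∑ i, fderiv ℝ (fun y => dualComponent i (α y)) x (stdVec i) := by
  rw [density, extDeriv, ContinuousAlternatingMap.alternatizeUncurryFin_apply]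
  refine Finset.sum_congr rfl fun i _ => ?_
  have hcomp : HasFDerivAt (fun y => dualComponent i (α y)) (dualComponent i ∘L fderiv ℝ α x) x :=
    (dualComponent i).hasFDerivAt.comp x hα.hasFDerivAt
  rw [hcomp.fderiv, ← Int.cast_smul_eq_zsmul ℂ]
  push_cast
  rfl

theorem stokes_shell_of_contDiff {α : E4 → Form 3} (hα : ContDiff ℝ ∞ α) {s t : ℝ} (hs : 0 ≤ s)
    (hst : s ≤ t) :
    ∫ x in shell s t, density (extDeriv α) x = sliceIntegral t α - sliceIntegral s α := by
  have hα₁ : ContDiff ℝ 1 α := hα.of_le (by simp)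
  have hcomp (i : Fin 4) : ContDiff ℝ 1 fun x => dualComponent i (α x) := by fun_prop
  have hint (i : Fin 4) : IntegrableOn
      (fun x => fderiv ℝ (fun y => dualComponent i (α y)) x (stdVec i)) (shell s t) :=
    (((hcomp i).continuous_fderiv one_ne_zero).clm_apply continuous_const
      |>.continuousOn.integrableOn_compact (isCompact_closedBall (0 : E4) t)).mono_set
        fun x hx => by simpa using hx.2.le
  have hslice (r : ℝ) : sliceIntegral r α = ∑ i, sphereIntegral volume
      (fun n x => ⟪n, stdVec i⟫_ℝ • dualComponent i (α x)) r := by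
    have hc := hα.continuous
    rw [sliceIntegral_eq_sphereIntegral, ← sphereIntegral_sum fun i => by fun_prop]
    simp only [fluxDensity]
  simp only [density_extDeriv (hα₁.differentiable one_ne_zero _), hslice]
  rw [integral_finsetSum _ fun i _ => hint i, ← Finset.sum_sub_distrib]
  exact Finset.sum_congr rfl fun i _ =>
    setIntegral_fderiv_norm_preimage_Ioo (hcomp i) (stdVec i) hs hst

theorem norm_smul_sphere {t : ℝ} (ht : 0 ≤ t) (n : Metric.sphere (0 : E4) 1) :
    ‖t • (n : E4)‖ = t := by
  rw [norm_smul, norm_eq_of_mem_sphere, mul_one, Real.norm_of_nonneg ht]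

theorem sliceIntegral_congr {α β : E4 → Form 3} {t : ℝ} (ht : 0 ≤ t)
    (h : ∀ x, ‖x‖ = t → α x = β x) : sliceIntegral t α = sliceIntegral t β := by
  simp only [sliceIntegral, h _ (norm_smul_sphere ht _)]

theorem stokes_shell {α : E4 → Form 3} (hα : ContDiffOn ℝ ∞ α spacetime) {s t : ℝ} (hs : 1 < s)
    (hst : s ≤ t) (ht : t < 2) :
    ∫ x in shell s t, density (extDeriv α) x = sliceIntegral t α - sliceIntegral s α := by
  obtain ⟨β, hβ, hβα⟩ := exists_contDiff_eventuallyEq_nhdsSet hα isOpen_spacetime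
    (isClosed_Icc.preimage continuous_norm : IsClosed (norm ⁻¹' Set.Icc s t))
    fun x hx => ⟨hs.trans_le hx.1, hx.2.trans_lt ht⟩
  have hnear {x : E4} (hx : ‖x‖ ∈ Set.Icc s t) : β =ᶠ[𝓝 x] α :=
    hβα.filter_mono (nhds_le_nhdsSet hx)
  have hslice {r : ℝ} (hr : r ∈ Set.Icc s t) : sliceIntegral r β = sliceIntegral r α :=
    sliceIntegral_congr (by linarith [hr.1]) fun x hx => (hnear (hx ▸ hr)).eq_of_nhds
  rw [← hslice (Set.right_mem_Icc.2 hst), ← hslice (Set.left_mem_Icc.2 hst),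
    ← stokes_shell_of_contDiff hβ (by linarith) hst]
  refine setIntegral_congr_fun (isOpen_shell s t).measurableSet fun x hx => ?_
  simp only [density, (hnear ⟨hx.1.le, hx.2.le⟩).extDeriv_eq]

theorem sliceIntegral_extDeriv {β : E4 → Form 2} (hβ : ContDiffOn ℝ ∞ β spacetime) {t : ℝ}
    (ht : t ∈ Set.Ioo 1 2) : sliceIntegral t (extDeriv β) = 0 := by
  obtain ⟨γ, hγ, hγβ⟩ := exists_contDiff_eventuallyEq_nhdsSet hβ isOpen_spacetime
    (Metric.isClosed_sphere (x := (0 : E4)) (ε := t)) fun x hx => by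
      rwa [← mem_sphere_zero_iff_norm.1 hx] at ht
  have hdγ : ContDiff ℝ ∞ (extDeriv γ) :=
    contDiffOn_univ.1 (contDiffOn_extDeriv isOpen_univ hγ.contDiffOn)
  have hddγ (x : E4) : extDeriv (extDeriv γ) x = 0 :=
    extDeriv_extDeriv_apply hγ.contDiffAt (by
      rw [minSmoothness_of_isRCLikeNormedField]
      exact ENat.LEInfty.out)
  have hcenter : sliceIntegral 0 (extDeriv γ) = 0 := by simp [sliceIntegral]
  have hstokes := stokes_shell_of_contDiff hdγ le_rfl (by linarith [ht.1] : 0 ≤ t)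
  rw [sliceIntegral_congr (by linarith [ht.1]) fun x hx => (hγβ.filter_mono (nhds_le_nhdsSet
    (mem_sphere_zero_iff_norm.2 hx))).extDeriv_eq.symm]
  simpa [density, hddγ, hcenter] using hstokes.symm

theorem sliceIntegral_add {α β : E4 → Form 3} (hα : ContDiffOn ℝ ∞ α spacetime)
    (hβ : ContDiffOn ℝ ∞ β spacetime) {t : ℝ} (ht : t ∈ Set.Ioo 1 2) :
    sliceIntegral t (fun x => α x + β x) = sliceIntegral t α + sliceIntegral t β := by
  have hint {η : E4 → Form 3} (hη : ContDiffOn ℝ ∞ η spacetime) :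
      Integrable (fun n : Metric.sphere (0 : E4) 1 => fluxDensity n (η (t • (n : E4))))
        (volume : Measure E4).toSphere := by
    have hη' : Continuous fun n : Metric.sphere (0 : E4) 1 => η (t • (n : E4)) :=
      hη.continuousOn.comp_continuous (by fun_prop) fun n => by
        rwa [← norm_smul_sphere (by linarith [ht.1] : 0 ≤ t) n] at ht
    have hcomp (i : Fin 4) : Continuous fun n : Metric.sphere (0 : E4) 1 =>
        dualComponent i (η (t • (n : E4))) := (dualComponent i).continuous.comp hη'
    unfold fluxDensity
    exact Continuous.integrable_of_hasCompactSupport (by fun_prop)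
      (HasCompactSupport.of_compactSpace _)
  simp only [sliceIntegral_eq_sphereIntegral, sphereIntegral, fluxDensity_add]
  rw [integral_add (hint hα) (hint hβ), smul_add]

theorem sliceIntegral_smul (c : ℂ) (α : E4 → Form 3) (t : ℝ) :
    sliceIntegral t (fun x => c • α x) = c * sliceIntegral t α := by
  simp only [sliceIntegral_eq_sphereIntegral, sphereIntegral, fluxDensity_smul,
    integral_const_mul, mul_smul_comm]

theorem sliceIntegral_sub {α β : E4 → Form 3} (hα : ContDiffOn ℝ ∞ α spacetime)
    (hβ : ContDiffOn ℝ ∞ β spacetime) {t : ℝ} (ht : t ∈ Set.Ioo 1 2) :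
    sliceIntegral t (fun x => α x - β x) = sliceIntegral t α - sliceIntegral t β := by
  simpa only [sub_add_cancel, eq_sub_iff_add_eq] using
    (sliceIntegral_add (hα.sub hβ) hβ ht).symm

/-! ### The generating functional -/

theorem cubic_comm {Sig : SpinForm 2} (hS : ∀ A B, Sig A B = Sig B A) (α β : SpinForm 1)
    (x : E4) : cubic Sig α β x = cubic Sig β α x := by
  have seesaw (A B : Fin 2) : ∑ C, (wedge (mixed α C A x) (β C B x) : Form 2) =
      ∑ C, (wedge (mixed β C B x) (α C A x) : Form 2) := by
    have anti (C D : Fin 2) : (wedge (α C A x) (β D B x) : Form 2) =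
        -wedge (β D B x) (α C A x) := by
      rw [wedge_comm_graded (β D B x) (α C A x) rfl rfl]
      module
    simp only [Fin.sum_univ_two, mixed_zero, mixed_one, neg_wedge, anti]
    abel
  simp only [cubic, ← wedge_sum, seesaw]
  rw [Finset.sum_comm]
  simp only [hS]

theorem pair_lower_comm (α β : SpinForm 2) (x : E4) :
    pair α (lower β) (m := 4) rfl x = pair β (lower α) (m := 4) rfl x := by
  have h := congrFun (pair_raise_comm (m := 4) (raise β) (raise α) rfl rfl) x
  rw [raise_raise, raise_raise] at h
  rw [lower_eq_raise, lower_eq_raise, h]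
  module

theorem shell_subset_spacetime {s t : ℝ} (hs : 1 ≤ s) (ht : t ≤ 2) : shell s t ⊆ spacetime :=
  fun _ hx => ⟨hs.trans_lt hx.1, hx.2.trans_le ht⟩

theorem eventually_lt_le_lt :
    ∀ᶠ p : ℝ × ℝ in 𝓝[>] 1 ×ˢ 𝓝[<] 2, 1 < p.1 ∧ p.1 ≤ p.2 ∧ p.2 < 2 := by
  have near_one : ∀ᶠ s in 𝓝[>] (1 : ℝ), s ∈ Set.Ioo (1 : ℝ) (3 / 2) :=
    Ioo_mem_nhdsGT (by norm_num)
  have near_two : ∀ᶠ t in 𝓝[<] (2 : ℝ), t ∈ Set.Ioo (3 / 2 : ℝ) 2 :=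
    Ioo_mem_nhdsLT (by norm_num)
  filter_upwards [near_one.prod_mk near_two] with p hp
  exact ⟨hp.1.1, (hp.1.2.trans hp.2.1).le, hp.2.2⟩

theorem hasBulkIntegral_of_integrableOn {η : E4 → Form 4}
    (hη : IntegrableOn (density η) spacetime) :
    HasBulkIntegral η (∫ x in spacetime, density η x) := by
  have hm (s t : ℝ) : MeasurableSet (shell s t) := (isOpen_shell s t).measurableSet
  simp only [HasBulkIntegral, ← integral_indicator (hm _ _),
    ← integral_indicator isOpen_spacetime.measurableSet]
  refine tendsto_integral_filter_of_dominated_convergence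
    (spacetime.indicator fun x => ‖density η x‖) ?_ ?_
    (IntegrableOn.integrable_indicator hη.norm isOpen_spacetime.measurableSet)
    (.of_forall fun x => ?_)
  · filter_upwards [eventually_lt_le_lt] with p hp
    exact ((hη.mono_set (shell_subset_spacetime hp.1.le hp.2.2.le)).integrable_indicator
      (hm _ _)).aestronglyMeasurable
  · filter_upwards [eventually_lt_le_lt] with p hp
    refine .of_forall fun x => ?_
    rw [norm_indicator_eq_indicator_norm]
    exact Set.indicator_le_indicator_of_subset (shell_subset_spacetime hp.1.le hp.2.2.le)
      (fun _ => norm_nonneg _) x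
  · refine tendsto_const_nhds.congr' ?_
    by_cases hx : x ∈ spacetime
    · have hx₁ : ∀ᶠ s in 𝓝[>] (1 : ℝ), s ∈ Set.Ioo 1 ‖x‖ := Ioo_mem_nhdsGT hx.1
      have hx₂ : ∀ᶠ t in 𝓝[<] (2 : ℝ), t ∈ Set.Ioo ‖x‖ 2 := Ioo_mem_nhdsLT hx.2
      filter_upwards [hx₁.prod_mk hx₂] with p hp
      have hxp : x ∈ shell p.1 p.2 := ⟨hp.1.2, hp.2.1⟩
      rw [Set.indicator_of_mem hx, Set.indicator_of_mem hxp]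
    · filter_upwards [eventually_lt_le_lt] with p hp
      rw [Set.indicator_of_notMem hx, Set.indicator_of_notMem
        fun h => hx (shell_subset_spacetime hp.1.le hp.2.2.le h)]

section Solutions

variable {κ Λ t : ℝ} {b : Background} {h k : State}

theorem contDiffOn_pair_sig_gam (hh : h.IsSolution Λ b) (hk : k.IsSolution Λ b) :
    ContDiffOn ℝ ∞ (pair h.sig k.gam (m := 3)) spacetime :=
  contDiffOn_pair _ hh.sig_symm_smooth hk.gam_symm_smooth

theorem contDiffOn_pair_gam_weylAct (hb : b.IsSelfDual Λ) (hh : h.IsSolution Λ b)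
    (hk : k.IsSolution Λ b) :
    ContDiffOn ℝ ∞ (pair (raise h.gam) (weylAct k.psi b.Sig) (m := 3)) spacetime :=
  contDiffOn_pair _ hh.gam_symm_smooth.raise (.weylAct hk.psi_weyl hb.sig_symm_smooth)

theorem integral_bulkForm (hb : b.IsSelfDual Λ) (hh : h.IsSolution Λ b) (hk : k.IsSolution Λ b)
    {s : ℝ} (hs : 1 < s) (hst : s ≤ t) (ht : t < 2) :
    ∫ x in shell s t, density (bulkForm κ Λ b h k) x = inner κ t k h - inner κ s k h := by
  simp only [inner, slicePairing]
  rw [← mul_sub, ← stokes_shell (contDiffOn_pair_sig_gam hh hk) hs hst ht, ← integral_const_mul]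
  refine setIntegral_congr_fun (isOpen_shell s t).measurableSet fun x hx => ?_
  simp only [density, bulkForm]
  rw [extDeriv_pair_sig_gam hb hh hk (shell_subset_spacetime hs.le ht.le hx)]
  simp only [ContinuousAlternatingMap.smul_apply, ContinuousAlternatingMap.neg_apply, smul_eq_mul,
    neg_mul_neg]

theorem hasAmplitude_iff_hasBulkIntegral (hb : b.IsSelfDual Λ) (hh : h.IsSolution Λ b)
    (hk : k.IsSolution Λ b) (hpast : Tendsto (fun t => slicePairing t h k) (𝓝[>] 1) (𝓝 0))
    (I : ℂ) : HasAmplitude κ k h I ↔ HasBulkIntegral (bulkForm κ Λ b h k) I := by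
  have past_term : Tendsto (fun p : ℝ × ℝ => inner κ p.1 k h) (𝓝[>] 1 ×ˢ 𝓝[<] 2) (𝓝 0) := by
    simpa [inner] using (hpast.comp tendsto_fst).const_mul (-(Complex.I / (κ : ℂ) ^ 2))
  have future_term : HasAmplitude κ k h I ↔
      Tendsto (fun p : ℝ × ℝ => inner κ p.2 k h) (𝓝[>] 1 ×ˢ 𝓝[<] 2) (𝓝 I) := by
    rw [HasAmplitude, ← map_snd_prod (𝓝[>] (1 : ℝ)) (𝓝[<] (2 : ℝ)), tendsto_map'_iff,
      map_snd_prod]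
    rfl
  have stokes : (fun p : ℝ × ℝ => ∫ x in shell p.1 p.2, density (bulkForm κ Λ b h k) x)
      =ᶠ[𝓝[>] 1 ×ˢ 𝓝[<] 2] fun p => inner κ p.2 k h - inner κ p.1 k h := by
    filter_upwards [eventually_lt_le_lt] with p hp
    exact integral_bulkForm hb hh hk hp.1 hp.2.1 hp.2.2
  rw [HasBulkIntegral, tendsto_congr' stokes, future_term]
  exact ⟨fun H => by simpa using H.sub past_term, fun H => by simpa using H.add past_term⟩

theorem slicePairing_sub_swap (hb : b.IsSelfDual Λ) (hh : h.IsSolution Λ b)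
    (hk : k.IsSolution Λ b) (ht : t ∈ Set.Ioo 1 2) :
    ((Λ / 3 : ℝ) : ℂ) * (slicePairing t h k - slicePairing t k h) =
      weylFlux b t h k - weylFlux b t k h := by
  have smooth_current : ContDiffOn ℝ ∞ (pair (raise h.gam) k.gam (m := 2)) spacetime :=
    contDiffOn_pair _ hh.gam_symm_smooth.raise hk.gam_symm_smooth
  have smooth_exact := contDiffOn_extDeriv isOpen_spacetime smooth_current
  have smooth_hk := contDiffOn_pair_gam_weylAct hb hh hk
  have smooth_kh := contDiffOn_pair_gam_weylAct hb hk hh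
  have pointwise := sliceIntegral_congr (by linarith [ht.1] : 0 ≤ t) fun x hx =>
    pair_sig_gam_sub_swap hb hh hk (x := x) (by rwa [← hx] at ht)
  rwa [sliceIntegral_smul, sliceIntegral_sub (contDiffOn_pair_sig_gam hh hk)
    (contDiffOn_pair_sig_gam hk hh) ht, sliceIntegral_sub (smooth_exact.add smooth_hk) smooth_kh ht,
    sliceIntegral_add smooth_exact smooth_hk ht, sliceIntegral_extDeriv smooth_current ht,
    zero_add] at pointwise

theorem slicePairing_sub_swap_const (hb : b.IsSelfDual Λ) (hh : h.IsSolution Λ b)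
    (hk : k.IsSolution Λ b) {s : ℝ} (hs : s ∈ Set.Ioo 1 2) (ht : t ∈ Set.Ioo 1 2) :
    slicePairing s h k - slicePairing s k h = slicePairing t h k - slicePairing t k h := by
  wlog hst : s ≤ t generalizing s t
  · exact (this ht hs (le_of_not_ge hst)).symm
  have same_bulk : ∫ x in shell s t, density (extDeriv (pair h.sig k.gam (m := 3))) x =
      ∫ x in shell s t, density (extDeriv (pair k.sig h.gam (m := 3))) x := by
    refine setIntegral_congr_fun (isOpen_shell s t).measurableSet fun x hx => ?_
    have hx' := shell_subset_spacetime hs.1.le ht.2.le hx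
    simp only [density, extDeriv_pair_sig_gam hb hh hk hx', extDeriv_pair_sig_gam hb hk hh hx',
      cubic_comm hb.sig_symm_smooth.1 h.gam, pair_lower_comm h.sig]
  rw [stokes_shell (contDiffOn_pair_sig_gam hh hk) hs.1 hst ht.2,
    stokes_shell (contDiffOn_pair_sig_gam hk hh) hs.1 hst ht.2] at same_bulk
  simp only [slicePairing]
  linear_combination -same_bulk

theorem weylFlux_eq_zero_of_weylFree (hk : k.WeylFree) (ht : t ∈ Set.Ioo 1 2) :
    weylFlux b t h k = 0 := by
  rw [weylFlux, sliceIntegral_congr (β := 0) (by linarith [ht.1]) fun x hx => ?_]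
  · simp [sliceIntegral]
  · have hx' : x ∈ spacetime := by rwa [← hx] at ht
    have weyl_term (A B : Fin 2) : weylAct k.psi b.Sig A B x = 0 := by
      ext v
      simp [weylAct, hk x hx']
    simp only [pair, weyl_term, wedge_zero, Finset.sum_const_zero, Pi.zero_apply]

theorem weylFlux_eq_zero_of_isPureGauge (hb : b.IsSelfDual Λ) (hh : h.IsPureGauge b)
    (hk : k.IsSolution Λ b) (ht : t ∈ Set.Ioo 1 2) : weylFlux b t h k = 0 := by
  obtain ⟨-, X, Y, θ, hX, hY, hθ, gauge⟩ := hh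
  have smooth_potential : ContDiffOn ℝ ∞ (pair (raise (gaugeParameter X Y b.Gam θ))
      (weylAct k.psi b.Sig) (m := 2)) spacetime :=
    contDiffOn_pair _ (hb.gam_symm_smooth.gaugeParameter hX hY hθ).raise
      (.weylAct hk.psi_weyl hb.sig_symm_smooth)
  have exact_flux : sliceIntegral t (pair (raise h.gam) (weylAct k.psi b.Sig) (m := 3)) =
      sliceIntegral t fun x => (-1 : ℂ) • extDeriv (pair (raise (gaugeParameter X Y b.Gam θ))
        (weylAct k.psi b.Sig) (m := 2)) x := by
    refine sliceIntegral_congr (by linarith [ht.1]) fun x hx => ?_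
    have hx' : x ∈ spacetime := by rwa [← hx] at ht
    rw [pair_raise_weylAct_of_gauge hb hk hX hY hθ hx' fun A B => (gauge x hx' A B).2]
    module
  rw [weylFlux, exact_flux, sliceIntegral_smul, sliceIntegral_extDeriv smooth_potential ht,
    mul_zero]

theorem hasBulkIntegral_symplectic (hb : b.IsSelfDual Λ) (hh : h.IsSolution Λ b)
    (hk : k.IsSolution Λ b) (hpast : Tendsto (fun t => slicePairing t h k) (𝓝[>] 1) (𝓝 0))
    (hfut : Tendsto (fun t => slicePairing t k h) (𝓝[<] 2) (𝓝 0)) (ht : t ∈ Set.Ioo 1 2) :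
    HasBulkIntegral (bulkForm κ Λ b h k)
      (-(Complex.I / (κ : ℂ) ^ 2) * (slicePairing t h k - slicePairing t k h)) := by
  rw [← hasAmplitude_iff_hasBulkIntegral hb hh hk hpast]
  refine Tendsto.const_mul _ ?_
  have conserved : (fun s => slicePairing t h k - slicePairing t k h + slicePairing s k h)
      =ᶠ[𝓝[<] 2] fun s => slicePairing s h k := by
    filter_upwards [Ioo_mem_nhdsLT one_lt_two] with s hs
    rw [← slicePairing_sub_swap_const hb hh hk hs ht, sub_add_cancel]
  refine Tendsto.congr' conserved ?_
  simpa using hfut.const_add (slicePairing t h k - slicePairing t k h)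

theorem hasBulkIntegral_zero_iff (hκ : κ ≠ 0) (hb : b.IsSelfDual Λ) (hh : h.IsSolution Λ b)
    (hk : k.IsSolution Λ b) (hpast : Tendsto (fun t => slicePairing t h k) (𝓝[>] 1) (𝓝 0))
    (hfut : Tendsto (fun t => slicePairing t k h) (𝓝[<] 2) (𝓝 0)) :
    HasBulkIntegral (bulkForm κ Λ b h k) 0 ↔
      Tendsto (fun t => slicePairing t k h) (𝓝[>] 1) (𝓝 0) := by
  have mem : (3 / 2 : ℝ) ∈ Set.Ioo 1 2 := by norm_num
  set c : ℂ := slicePairing (3 / 2) h k - slicePairing (3 / 2) k h with hc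
  have bulk : HasBulkIntegral (bulkForm κ Λ b h k) (-(Complex.I / (κ : ℂ) ^ 2) * c) :=
    hasBulkIntegral_symplectic hb hh hk hpast hfut mem
  have past : Tendsto (fun t => slicePairing t k h) (𝓝[>] 1) (𝓝 (-c)) := by
    have conserved : (fun s => slicePairing s h k - c) =ᶠ[𝓝[>] 1]
        fun s => slicePairing s k h := by
      filter_upwards [Ioo_mem_nhdsGT one_lt_two] with s hs
      rw [hc, ← slicePairing_sub_swap_const hb hh hk hs mem, sub_sub_cancel]
    simpa using (hpast.sub_const c).congr' conserved
  have bulk_zero_iff : HasBulkIntegral (bulkForm κ Λ b h k) 0 ↔ c = 0 :=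
    ⟨fun H => by simpa [hκ] using tendsto_nhds_unique bulk H, fun H => by simpa [H] using bulk⟩
  have past_zero_iff : Tendsto (fun t => slicePairing t k h) (𝓝[>] 1) (𝓝 0) ↔ c = 0 :=
    ⟨fun H => neg_eq_zero.1 (tendsto_nhds_unique past H), fun H => by simpa [H] using past⟩
  rw [bulk_zero_iff, past_zero_iff]

theorem hasBulkIntegral_weylFlux (hΛ : Λ ≠ 0) (hb : b.IsSelfDual Λ) (hh : h.IsSolution Λ b)
    (hk : k.IsSolution Λ b) (hpast : Tendsto (fun t => slicePairing t h k) (𝓝[>] 1) (𝓝 0))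
    (hfut : Tendsto (fun t => slicePairing t k h) (𝓝[<] 2) (𝓝 0)) (ht : t ∈ Set.Ioo 1 2) :
    HasBulkIntegral (bulkForm κ Λ b h k)
      (-(3 * Complex.I / (Λ * κ ^ 2)) * (weylFlux b t h k - weylFlux b t k h)) := by
  have hΛ' : (Λ : ℂ) ≠ 0 := by exact_mod_cast hΛ
  rw [← slicePairing_sub_swap hb hh hk ht]
  convert hasBulkIntegral_symplectic (κ := κ) hb hh hk hpast hfut ht using 1
  push_cast
  field_simp

theorem mainTheorem5_general (hκ : κ ≠ 0) (hΛ : Λ ≠ 0) (hb : b.IsSelfDual Λ) {h₁ h₂ : State}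
    (hh₁ : h₁.IsSolution Λ b) (hh₂ : h₂.IsSolution Λ b)
    (hpast : Tendsto (fun t => slicePairing t h₁ h₂) (𝓝[>] 1) (𝓝 0)) :
    (∀ I : ℂ, HasAmplitude κ h₂ h₁ I ↔ HasBulkIntegral (bulkForm κ Λ b h₁ h₂) I) ∧
    (IntegrableOn (density (bulkForm κ Λ b h₁ h₂)) spacetime →
      HasAmplitude κ h₂ h₁ (∫ x in spacetime, density (bulkForm κ Λ b h₁ h₂) x)) ∧
    (Tendsto (fun t => slicePairing t h₂ h₁) (𝓝[<] 2) (𝓝 0) →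
      (h₁.IsPureGauge b ∨ h₂.IsPureGauge b → HasBulkIntegral (bulkForm κ Λ b h₁ h₂) 0) ∧
      (h₁.WeylFree →
        (∀ t ∈ Set.Ioo (1 : ℝ) 2, HasBulkIntegral (bulkForm κ Λ b h₁ h₂)
          (-(3 * Complex.I / (Λ * κ ^ 2)) * weylFlux b t h₁ h₂)) ∧
        (HasBulkIntegral (bulkForm κ Λ b h₁ h₂) 0 ↔
          Tendsto (fun t => slicePairing t h₂ h₁) (𝓝[>] 1) (𝓝 0))) ∧
      (h₂.WeylFree → ∀ t ∈ Set.Ioo (1 : ℝ) 2, HasBulkIntegral (bulkForm κ Λ b h₁ h₂)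
        ((3 * Complex.I / (Λ * κ ^ 2)) * weylFlux b t h₂ h₁))) := by
  have amplitude := hasAmplitude_iff_hasBulkIntegral (κ := κ) hb hh₁ hh₂ hpast
  refine ⟨amplitude, fun hint => (amplitude _).2 (hasBulkIntegral_of_integrableOn hint),
    fun hfut => ?_⟩
  have bulk {t : ℝ} (ht : t ∈ Set.Ioo 1 2) :=
    hasBulkIntegral_weylFlux (κ := κ) hΛ hb hh₁ hh₂ hpast hfut ht
  have mem : (3 / 2 : ℝ) ∈ Set.Ioo 1 2 := by norm_num
  refine ⟨?_, fun hw => ⟨fun t ht => ?_, hasBulkIntegral_zero_iff hκ hb hh₁ hh₂ hpast hfut⟩,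
    fun hw t ht => ?_⟩
  · rintro (gauge | gauge)
    · simpa [weylFlux_eq_zero_of_isPureGauge hb gauge hh₂ mem,
        weylFlux_eq_zero_of_weylFree gauge.1 mem] using bulk mem
    · simpa [weylFlux_eq_zero_of_isPureGauge hb gauge hh₁ mem,
        weylFlux_eq_zero_of_weylFree gauge.1 mem] using bulk mem
  · simpa [weylFlux_eq_zero_of_weylFree hw ht] using bulk ht
  · simpa [weylFlux_eq_zero_of_weylFree hw ht] using bulk ht

end Solutions

end MHV

end

theorem mainTheorem5 (κ Λ : ℝ) (hκ : 0 < κ) (hΛ : 0 < Λ)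
    (b : MHV.Background) (hb : b.IsSelfDual Λ)
    (W : Set MHV.State) (hW : ∀ h ∈ W, h.IsSolution Λ b)
    (h₁ h₂ : MHV.State) (h₁W : h₁ ∈ W) (h₂W : h₂ ∈ W)
    (h₁past : MHV.IsASDPast W h₁) :
    (∀ I : ℂ, MHV.HasAmplitude κ h₂ h₁ I ↔
      MHV.HasBulkIntegral (MHV.bulkForm κ Λ b h₁ h₂) I) ∧
    (IntegrableOn (MHV.density (MHV.bulkForm κ Λ b h₁ h₂)) MHV.spacetime →
      MHV.HasAmplitude κ h₂ h₁
        (∫ x in MHV.spacetime, MHV.density (MHV.bulkForm κ Λ b h₁ h₂) x)) ∧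
    (MHV.IsASDFuture W h₂ →
      (h₁.IsPureGauge b ∨ h₂.IsPureGauge b →
        MHV.HasBulkIntegral (MHV.bulkForm κ Λ b h₁ h₂) 0) ∧
      (h₁.WeylFree →
        (∀ t ∈ Set.Ioo (1 : ℝ) 2, MHV.HasBulkIntegral (MHV.bulkForm κ Λ b h₁ h₂)
          (-(3 * Complex.I / (Λ * κ ^ 2)) * MHV.weylFlux b t h₁ h₂)) ∧
        (MHV.HasBulkIntegral (MHV.bulkForm κ Λ b h₁ h₂) 0 ↔
          Tendsto (fun t => MHV.slicePairing t h₂ h₁) (𝓝[>] (1 : ℝ)) (𝓝 0))) ∧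
      (h₂.WeylFree →
        ∀ t ∈ Set.Ioo (1 : ℝ) 2, MHV.HasBulkIntegral (MHV.bulkForm κ Λ b h₁ h₂)
          ((3 * Complex.I / (Λ * κ ^ 2)) * MHV.weylFlux b t h₂ h₁))) := by
  obtain ⟨amplitude, integrable, bulk⟩ := MHV.mainTheorem5_general hκ.ne' hΛ.ne' hb (hW h₁ h₁W)
    (hW h₂ h₂W) (h₁past h₂ h₂W)
  exact ⟨amplitude, integrable, fun h₂future => bulk (h₂future h₁ h₁W)⟩
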